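/- Let $B=\operatorname{diag}(b_1,\dots,b_n)$ with $b_1,\dots,b_n\in\mathbb C\setminus\{0\}$, and let $\mathfrak H=L^2([0,1];\mathbb C^n)$. For a potential $Q\in L^1([0,1];\mathbb C^{n\times n})$ put $L(Q)y=-iB^{-1}y'+Q(x)y$, and for $C,D\in\mathbb C^{n\times n}$ with $\operatorname{rank}\begin{pmatrix}C & D\end{pmatrix}=n$ let $L_{C,D}(Q)$ be the operator $y\mapsto L(Q)y$ in $\mathfrak H$ with domain $$\{\,y\in W^{1,1}([0,1];\mathbb C^n): L(Q)y\in\mathfrak H,\ Cy(0)+Dy(1)=0\,\}.$$ Let $Q_1,Q_2\in L^1([0,1];\mathbb C^{n\times n})$, let $C_1,D_1,C_2,D_2\in\mathbb C^{n\times n}$ satisfy $\operatorname{rank}\begin{pmatrix}C_j & D_j\end{pmatrix}=n$, $j\in\{1,2\}$, and let $\lambda$ belong to the resolvent sets of both $L_{C_1,D_1}(Q_1)$ and $L_{C_2,D_2}(Q_2)$. Then the difference $$(L_{C_1,D_1}(Q_1)-\lambda)^{-1}-(L_{C_2,D_2}(Q_2)-\lambda)^{-1}$$ is a trace class operator in $\mathfrak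 H$. Moreover, the equations $L(Q_j)y=\lambda y$ have fundamental matrices $\Phi_j(\cdot,\lambda)$ on $[0,1]$ with entries in $W^{1,1}[0,1]$ and $\Phi_j(0,\lambda)=I_n$; the matrices $\Phi_j(x,\lambda)$, $x\in[0,1]$, and $C_j+D_j\Phi_j(1,\lambda)$ are invertible, $j\in\{1,2\}$; and, the integral being convergent, $$\operatorname{tr}\bigl((L_{C_1,D_1}(Q_1)-\lambda)^{-1}-(L_{C_2,D_2}(Q_2)-\lambda)^{-1}\bigr)$$ $$=\operatorname{tr}\int_0^1\Bigl(\Phi_1(x,\lambda)(C_1+D_1\Phi_1(1,\lambda))^{-1}C_1\Phi_1(x,\lambda)^{-1}-\Phi_2(x,\lambda)(C_2+D_2\Phi_2(1,\lambda))^{-1}C_2\Phi_2(x,\lambda)^{-1}\Bigr)iB\,dx .$$ -/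

import Mathlib

open MeasureTheory Set
open scoped InnerProductSpace Matrix

namespace DiracBVP

section Abstract

universe u

variable {H : Type u} [NormedAddCommGroup H] [InnerProductSpace ℂ H]

/-- `R` is the (everywhere defined, bounded) resolvent `(T - z)⁻¹` of the unbounded operator `T`. -/
def IsResolventAt (T : H →ₗ.[ℂ] H) (z : ℂ) (R : H →L[ℂ] H) : Prop :=
  (∀ f : H, ∃ hf : R f ∈ T.domain, T ⟨R f, hf⟩ - z • R f = f) ∧
    ∀ y : T.domain, R (T y - z • (y : H)) = y

/-- The resolvent set `ρ(T)` of an unbounded operator `T`. -/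
def resolventSetOf (T : H →ₗ.[ℂ] H) : Set ℂ :=
  {z | ∃ R : H →L[ℂ] H, IsResolventAt T z R}

open Classical in
/-- The resolvent `(T - z)⁻¹` for `z ∈ ρ(T)` (and `0` otherwise). -/
noncomputable def resolventOf (T : H →ₗ.[ℂ] H) (z : ℂ) : H →L[ℂ] H :=
  if h : z ∈ resolventSetOf T then Classical.choose h else 0

theorem resolventOf_spec {T : H →ₗ.[ℂ] H} {z : ℂ} (h : z ∈ resolventSetOf T) :
    IsResolventAt T z (resolventOf T z) := by
  unfold resolventOf
  rw [dif_pos h]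
  exact Classical.choose_spec h

/-- The trace class `𝔖₁(H)`: `∑ ⟨|T| e_i, e_i⟩ < ∞` for every orthonormal basis `(e_i)`, where
`|T| = (T* T)^{1/2}`. -/
def IsTraceClass [CompleteSpace H] (T : H →L[ℂ] H) : Prop :=
  ∀ (ι : Type u) (e : HilbertBasis ι ℂ H),
    Summable fun i => (⟪e i, CFC.abs T (e i)⟫_ℂ).re

/-- `tr T = t`: in every orthonormal basis `(e_i)` the series `∑ ⟨T e_i, e_i⟩` of diagonal matrix
elements converges to `t`. (Mathlib's inner product is conjugate linear in the first slot.) -/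
def HasTrace (T : H →L[ℂ] H) (t : ℂ) : Prop :=
  ∀ (ι : Type u) (e : HilbertBasis ι ℂ H), HasSum (fun i => ⟪e i, T (e i)⟫_ℂ) t

end Abstract

/-- Lebesgue measure on `[0,1]`. -/
noncomputable abbrev unitMeasure : Measure ℝ := volume.restrict (Icc (0 : ℝ) 1)

/-- `ℂⁿ` with its Euclidean structure. -/
abbrev Cn (n : ℕ) : Type := EuclideanSpace ℂ (Fin n)

/-- The Hilbert space `L²([0,1]; ℂⁿ)`. -/
abbrev L2 (n : ℕ) : Type := Lp (Cn n) 2 unitMeasure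

/-- `Q ∈ L¹([0,1]; ℂ^{n×n})`. -/
def IsL1Potential {n : ℕ} (Q : ℝ → Matrix (Fin n) (Fin n) ℂ) : Prop :=
  ∀ j k, IntegrableOn (fun x => Q x j k) (Icc (0 : ℝ) 1)

/-- `y ∈ W^{1,1}([0,1]; ℂⁿ)`: `y` is absolutely continuous on `[0,1]` and `y' ∈ L¹`. -/
def IsW11 {n : ℕ} (y : ℝ → Cn n) : Prop :=
  AbsolutelyContinuousOnInterval y 0 1 ∧ IntegrableOn (deriv y) (Icc (0 : ℝ) 1)

/-- The differential expression `L(Q)y = -i B⁻¹ y' + Q(x) y`, with `B = diag(b₁, …, bₙ)`. -/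
noncomputable def diffExpr {n : ℕ} (b : Fin n → ℂ) (Q : ℝ → Matrix (Fin n) (Fin n) ℂ)
    (y : ℝ → Cn n) (x : ℝ) : Cn n :=
  WithLp.toLp 2 (-Complex.I • ((Matrix.diagonal b)⁻¹ *ᵥ (deriv y x).ofLp) + Q x *ᵥ (y x).ofLp)

theorem IsW11.ae_differentiableAt {n : ℕ} {y : ℝ → Cn n} (hy : IsW11 y) :
    ∀ᵐ x ∂unitMeasure, DifferentiableAt ℝ y x := by
  rw [ae_restrict_iff' measurableSet_Icc]
  have := hy.1.boundedVariationOn.ae_differentiableAt_of_mem_uIcc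
  simpa [uIcc_of_le (zero_le_one' ℝ)] using this

theorem diffExpr_add {n : ℕ} (b : Fin n → ℂ) (Q : ℝ → Matrix (Fin n) (Fin n) ℂ)
    {u v : ℝ → Cn n} (hu : IsW11 u) (hv : IsW11 v) :
    diffExpr b Q (u + v) =ᵐ[unitMeasure] diffExpr b Q u + diffExpr b Q v := by
  filter_upwards [hu.ae_differentiableAt, hv.ae_differentiableAt] with x h1 h2
  simp only [diffExpr, Pi.add_apply, deriv_add h1 h2, WithLp.ofLp_add, Matrix.mulVec_add,
    smul_add, ← WithLp.toLp_add]
  congr 1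
  abel

theorem diffExpr_smul {n : ℕ} (b : Fin n → ℂ) (Q : ℝ → Matrix (Fin n) (Fin n) ℂ)
    {u : ℝ → Cn n} (c : ℂ) (hu : IsW11 u) :
    diffExpr b Q (c • u) =ᵐ[unitMeasure] c • diffExpr b Q u := by
  filter_upwards [hu.ae_differentiableAt] with x h1
  simp only [diffExpr, Pi.smul_apply, deriv_const_smul c h1, WithLp.ofLp_smul, Matrix.mulVec_smul,
    ← WithLp.toLp_smul, smul_add]
  rw [smul_comm c (-Complex.I)]

theorem IsW11.add {n : ℕ} {u v : ℝ → Cn n} (hu : IsW11 u) (hv : IsW11 v) : IsW11 (u + v) := by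
  refine ⟨hu.1.add hv.1, (hu.2.add hv.2).congr ?_⟩
  filter_upwards [hu.ae_differentiableAt, hv.ae_differentiableAt] with x h1 h2
  exact (deriv_add h1 h2).symm

theorem IsW11.smul {n : ℕ} {u : ℝ → Cn n} (c : ℂ) (hu : IsW11 u) : IsW11 (c • u) := by
  refine ⟨hu.1.const_smul c, (Integrable.smul c hu.2).congr ?_⟩
  filter_upwards [hu.ae_differentiableAt] with x h1
  exact (deriv_const_smul c h1).symm

theorem isW11_zero {n : ℕ} : IsW11 (0 : ℝ → Cn n) := by
  refine ⟨ContDiffOn.absolutelyContinuousOnInterval contDiffOn_const, ?_⟩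
  simp only [deriv_zero]
  exact integrable_zero _ _ _

/-- The graph of the operator `L_{C,D}(Q)` in `L²([0,1]; ℂⁿ)`: all pairs `(y, L(Q)y)` such that
(the continuous representative `u` of) `y` lies in `W^{1,1}`, `L(Q)y ∈ L²` and
`C y(0) + D y(1) = 0`. -/
def bvpGraph {n : ℕ} (b : Fin n → ℂ) (Q : ℝ → Matrix (Fin n) (Fin n) ℂ)
    (C D : Matrix (Fin n) (Fin n) ℂ) : Submodule ℂ (L2 n × L2 n) where
  carrier := {p | ∃ u : ℝ → Cn n, p.1 =ᵐ[unitMeasure] u ∧ IsW11 u ∧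
    p.2 =ᵐ[unitMeasure] diffExpr b Q u ∧ C *ᵥ (u 0).ofLp + D *ᵥ (u 1).ofLp = 0}
  zero_mem' := by
    refine ⟨0, Lp.coeFn_zero _ _ _, isW11_zero, ?_, by simp⟩
    refine (Lp.coeFn_zero _ _ _).trans (Filter.Eventually.of_forall fun x => ?_)
    simp [diffExpr]
  add_mem' := by
    rintro p q ⟨u, hu1, hu2, hu3, hu4⟩ ⟨v, hv1, hv2, hv3, hv4⟩
    refine ⟨u + v, (Lp.coeFn_add _ _).trans (hu1.add hv1), hu2.add hv2,
      ((Lp.coeFn_add _ _).trans (hu3.add hv3)).trans (diffExpr_add b Q hu2 hv2).symm, ?_⟩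
    simp only [Pi.add_apply, WithLp.ofLp_add, Matrix.mulVec_add]
    rw [add_add_add_comm, hu4, hv4, add_zero]
  smul_mem' := by
    rintro c p ⟨u, hu1, hu2, hu3, hu4⟩
    refine ⟨c • u, (Lp.coeFn_smul _ _).trans (hu1.const_smul c), hu2.smul c,
      ((Lp.coeFn_smul _ _).trans (hu3.const_smul c)).trans (diffExpr_smul b Q c hu2).symm, ?_⟩
    simp only [Pi.smul_apply, WithLp.ofLp_smul, Matrix.mulVec_smul]
    rw [← smul_add, hu4, smul_zero]

/-- The operator `L_{C,D}(Q)` in `L²([0,1]; ℂⁿ)`. -/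
noncomputable def bvpOperator {n : ℕ} (b : Fin n → ℂ) (Q : ℝ → Matrix (Fin n) (Fin n) ℂ)
    (C D : Matrix (Fin n) (Fin n) ℂ) : L2 n →ₗ.[ℂ] L2 n :=
  (bvpGraph b Q C D).toLinearPMap

theorem bvpGraph_single_valued {n : ℕ} (b : Fin n → ℂ) (Q : ℝ → Matrix (Fin n) (Fin n) ℂ)
    (C D : Matrix (Fin n) (Fin n) ℂ) (p : L2 n × L2 n) (hp : p ∈ bvpGraph b Q C D)
    (h0 : p.1 = 0) : p.2 = 0 := by
  obtain ⟨u, hu1, hu2, hu3, -⟩ := hp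
  rw [h0] at hu1
  have h1 : u =ᵐ[unitMeasure] (fun _ => 0) := hu1.symm.trans (Lp.coeFn_zero _ _ _)
  have hc : ContinuousOn u (Icc (0 : ℝ) 1) := by
    simpa [uIcc_of_le (zero_le_one' ℝ)] using hu2.1.continuousOn
  have h2 : EqOn u (fun _ => 0) (Icc (0 : ℝ) 1) :=
    Measure.eqOn_Icc_of_ae_eq volume zero_ne_one h1 hc continuousOn_const
  apply Lp.ext
  refine (hu3.trans ?_).trans (Lp.coeFn_zero _ _ _).symm
  have h3 : ∀ᵐ x ∂unitMeasure, x ∈ Ioo (0 : ℝ) 1 := by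
    rw [unitMeasure, ← restrict_Ioo_eq_restrict_Icc]
    exact ae_restrict_mem measurableSet_Ioo
  filter_upwards [h3] with x hx
  have h4 : u =ᶠ[nhds x] fun _ => 0 := by
    filter_upwards [isOpen_Ioo.mem_nhds hx] with t ht using h2 (Ioo_subset_Icc_self ht)
  simp [diffExpr, h4.deriv_eq, h4.eq_of_nhds]

theorem bvpOperator_graph {n : ℕ} (b : Fin n → ℂ) (Q : ℝ → Matrix (Fin n) (Fin n) ℂ)
    (C D : Matrix (Fin n) (Fin n) ℂ) : (bvpOperator b Q C D).graph = bvpGraph b Q C D :=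
  Submodule.toLinearPMap_graph_eq _ (bvpGraph_single_valued b Q C D)

/-- `Φ(·) = Φ(·, z)` is the fundamental matrix of `L(Q)y = z y` on `[0,1]` with `Φ(0) = Iₙ`: each
column of `Φ` lies in `W^{1,1}` and solves the equation almost everywhere. -/
def IsFundamentalMatrix {n : ℕ} (b : Fin n → ℂ) (Q : ℝ → Matrix (Fin n) (Fin n) ℂ) (z : ℂ)
    (Φ : ℝ → Matrix (Fin n) (Fin n) ℂ) : Prop :=
  Φ 0 = 1 ∧ ∀ k : Fin n,
    IsW11 (fun x => (WithLp.toLp 2 ((Φ x).col k) : Cn n)) ∧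
    ∀ᵐ x ∂unitMeasure, diffExpr b Q (fun t => WithLp.toLp 2 ((Φ t).col k)) x =
      z • (WithLp.toLp 2 ((Φ x).col k) : Cn n)

/-- The entrywise integral over `[0,1]` of a matrix function. -/
noncomputable def matrixIntegral {n : ℕ} (F : ℝ → Matrix (Fin n) (Fin n) ℂ) :
    Matrix (Fin n) (Fin n) ℂ :=
  Matrix.of fun j k => ∫ x in (0 : ℝ)..1, F x j k

/-- The matrix function
`x ↦ (Φ₁(x)(C₁+D₁Φ₁(1))⁻¹C₁Φ₁(x)⁻¹ - Φ₂(x)(C₂+D₂Φ₂(1))⁻¹C₂Φ₂(x)⁻¹) i B`. -/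
noncomputable def traceIntegrand {n : ℕ} (b : Fin n → ℂ)
    (C₁ D₁ C₂ D₂ : Matrix (Fin n) (Fin n) ℂ) (Φ₁ Φ₂ : ℝ → Matrix (Fin n) (Fin n) ℂ) (x : ℝ) :
    Matrix (Fin n) (Fin n) ℂ :=
  (Φ₁ x * (C₁ + D₁ * Φ₁ 1)⁻¹ * C₁ * (Φ₁ x)⁻¹ - Φ₂ x * (C₂ + D₂ * Φ₂ 1)⁻¹ * C₂ * (Φ₂ x)⁻¹) *
    (Complex.I • Matrix.diagonal b)

end DiracBVP

/-! Write `A_j = iB(z - Q_j)`, so that `L(Q_j)y = zy + f` reads `y' = A_j y + iBf`, and let `Ψ_j =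
Φ_j⁻¹`. Variation of constants (`IsFundamentalPair.eq_of_boundary`) gives the resolvent `R_j f(x) =
Φ_j(x) (N_j ∫₀¹ Ψ_j iBf dt - ∫ₓ¹ Ψ_j iBf dt)` with `N_j = (C_j + D_j Φ_j(1))⁻¹ C_j`. The first
summand has finite rank, and its trace is the integral of the matrix trace of its kernel on the
diagonal; these two integrals make up the formula.

A single Volterra summand need not be trace class, since its kernel jumps on the diagonal. In the
difference the jumps cancel: `w = Ψ₁(A₂ - A₁)Φ₂` is the `L¹` derivative of `Ψ₁Φ₂`, and integration
by parts (`mulVec_tailIntegral_sub`) rewrites the difference as `Φ₁(x) ∫ₓ¹ w(s) ∫ₛ¹ Ψ₂ iBf dt ds`.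
This is an integral over `s`, with `L¹` weights, of uniformly bounded rank one operators `1_{x ≤ s}
φ ⊗ 1_{t > s} ψ`, hence trace class. Each of them has trace zero because the two supports are
disjoint (`isNuclearForm_cutoff`), so the Volterra part does not contribute.

Trace class statements are proved for sesquilinear forms. An integral of rank one forms with
integrable norm bound has summable diagonals (`isNuclearForm_integral`), also after a bounded
operator is inserted; taking that operator from the polar decomposition covers `|T|`
(`exists_inner_abs_eq`). -/

namespace DiracBVP

/-! ### Trace class forms, integrals of rank one forms, and polar decomposition. -/

section NuclearForms

universe u

variable {H : Type u} [NormedAddCommGroup H] [InnerProductSpace ℂ H]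

/-- A form `β` on `H` which is trace class, with trace `t`: its diagonal sums converge in every
orthonormal basis, also after composition with a bounded operator, and sum up to `t`. -/
def IsNuclearForm (β : H → H → ℂ) (t : ℂ) : Prop :=
  ∀ (ι : Type u) (e : HilbertBasis ι ℂ H),
    (∀ U : H →L[ℂ] H, Summable fun i => β (U (e i)) (e i)) ∧ HasSum (fun i => β (e i) (e i)) t

theorem IsNuclearForm.sub {β γ : H → H → ℂ} {s t : ℂ} (hβ : IsNuclearForm β s)
    (hγ : IsNuclearForm γ t) : IsNuclearForm (fun g f => β g f - γ g f) (s - t) := fun ι e =>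
  ⟨fun U => ((hβ ι e).1 U).sub ((hγ ι e).1 U), (hβ ι e).2.sub (hγ ι e).2⟩

theorem IsNuclearForm.sum {κ : Type*} (s : Finset κ) {β : κ → H → H → ℂ} {t : κ → ℂ}
    (h : ∀ k ∈ s, IsNuclearForm (β k) (t k)) :
    IsNuclearForm (fun g f => ∑ k ∈ s, β k g f) (∑ k ∈ s, t k) := fun ι e =>
  ⟨fun U => summable_sum fun k hk => (h k hk ι e).1 U, hasSum_sum fun k hk => (h k hk ι e).2⟩

/-- Orthonormal vectors are `√2` apart, so the balls of radius `1/2` around them are disjoint.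
Countability is needed to exchange the sum over a basis with an integral. -/
theorem countable_of_orthonormal [TopologicalSpace.SeparableSpace H] {ι : Type*} {v : ι → H}
    (hv : Orthonormal ℂ v) : Countable ι := by
  refine Pairwise.countable_of_isOpen_disjoint (s := fun i => Metric.ball (v i) (1 / 2)) ?_
    (fun _ => Metric.isOpen_ball) (fun i => ⟨v i, by simp⟩)
  intro i j hij
  refine Metric.ball_disjoint_ball ?_
  have h : ‖v i - v j‖ ^ 2 = 2 := by
    rw [@norm_sub_sq ℂ, hv.2 hij, hv.1 i, hv.1 j]
    norm_num
  rw [dist_eq_norm]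
  nlinarith [norm_nonneg (v i - v j)]

/-- Cauchy–Schwarz, followed by Bessel's inequality for each factor. -/
theorem sum_norm_inner_mul_norm_inner_le {ι : Type*} {v : ι → H} (hv : Orthonormal ℂ v)
    (s : Finset ι) (x y : H) : ∑ i ∈ s, ‖⟪v i, x⟫_ℂ‖ * ‖⟪y, v i⟫_ℂ‖ ≤ ‖x‖ * ‖y‖ := by
  refine (Real.sum_mul_le_sqrt_mul_sqrt s _ _).trans ?_
  gcongr
  · exact Real.sqrt_le_iff.2 ⟨norm_nonneg _, hv.sum_inner_products_le x⟩
  · refine Real.sqrt_le_iff.2 ⟨norm_nonneg _, ?_⟩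
    simpa only [norm_inner_symm y] using hv.sum_inner_products_le (s := s) y

/-- For fixed `ω` the series is Parseval's identity for `⟪κ ω, α ω⟫`. By the preceding bound all
partial sums of absolute values stay below `ρ`, which permits integration term by term. -/
theorem hasSum_integral_inner_mul_inner [TopologicalSpace.SeparableSpace H] {Ω : Type*}
    [MeasurableSpace Ω] {μ : Measure Ω} {w : Ω → ℂ} {α κ : Ω → H} {ρ : Ω → ℝ}
    (hw : AEStronglyMeasurable w μ)
    (hα : ∀ g, AEStronglyMeasurable (fun ω => ⟪g, α ω⟫_ℂ) μ)
    (hκ : ∀ f, AEStronglyMeasurable (fun ω => ⟪κ ω, f⟫_ℂ) μ)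
    (hρ : Integrable ρ μ) (hle : ∀ᵐ ω ∂μ, ‖w ω‖ * (‖α ω‖ * ‖κ ω‖) ≤ ρ ω)
    {ι : Type*} (e : HilbertBasis ι ℂ H) :
    HasSum (fun i => ∫ ω, w ω * (⟪e i, α ω⟫_ℂ * ⟪κ ω, e i⟫_ℂ) ∂μ) (∫ ω, w ω * ⟪κ ω, α ω⟫_ℂ ∂μ) := by
  have : Countable ι := countable_of_orthonormal e.orthonormal
  have hsum : ∀ᵐ ω ∂μ, ∀ s : Finset ι,
      ∑ i ∈ s, ‖w ω * (⟪e i, α ω⟫_ℂ * ⟪κ ω, e i⟫_ℂ)‖ ≤ ρ ω := by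
    filter_upwards [hle] with ω h s
    refine le_trans ?_ h
    simp only [norm_mul, ← Finset.mul_sum]
    gcongr
    exact sum_norm_inner_mul_norm_inner_le e.orthonormal s _ _
  have hint : ∀ i, Integrable (fun ω => w ω * (⟪e i, α ω⟫_ℂ * ⟪κ ω, e i⟫_ℂ)) μ := by
    intro i
    refine hρ.mono' (hw.mul ((hα _).mul (hκ _))) ?_
    filter_upwards [hsum] with ω h
    simpa using h {i}
  have hsummable : Summable fun i => ∫ ω, ‖w ω * (⟪e i, α ω⟫_ℂ * ⟪κ ω, e i⟫_ℂ)‖ ∂μ := by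
    refine summable_of_sum_le (c := ∫ ω, ρ ω ∂μ)
      (fun i => integral_nonneg fun ω => norm_nonneg _) fun s => ?_
    rw [← integral_finsetSum _ fun i _ => (hint i).norm]
    refine integral_mono_ae (integrable_finsetSum _ fun i _ => (hint i).norm) hρ ?_
    filter_upwards [hsum] with ω h using h s
  have hlim : ∀ ω, ∑' i, w ω * (⟪e i, α ω⟫_ℂ * ⟪κ ω, e i⟫_ℂ) = w ω * ⟪κ ω, α ω⟫_ℂ := fun ω => by
    rw [tsum_mul_left, ← e.tsum_inner_mul_inner (κ ω) (α ω)]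
    simp only [mul_comm]
  simpa only [hlim] using hasSum_integral_of_summable_integral_norm hint hsummable

/-- The operator `U` passes to `α` as its adjoint, giving a family of the same kind with the bound
`‖U‖ * ρ`. -/
theorem isNuclearForm_integral [CompleteSpace H] [TopologicalSpace.SeparableSpace H] {Ω : Type*}
    [MeasurableSpace Ω] {μ : Measure Ω} {w : Ω → ℂ} {α κ : Ω → H} {ρ : Ω → ℝ}
    (hw : AEStronglyMeasurable w μ)
    (hα : ∀ g, AEStronglyMeasurable (fun ω => ⟪g, α ω⟫_ℂ) μ)
    (hκ : ∀ f, AEStronglyMeasurable (fun ω => ⟪κ ω, f⟫_ℂ) μ)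
    (hρ : Integrable ρ μ) (hle : ∀ᵐ ω ∂μ, ‖w ω‖ * (‖α ω‖ * ‖κ ω‖) ≤ ρ ω) :
    IsNuclearForm (fun g f => ∫ ω, w ω * (⟪g, α ω⟫_ℂ * ⟪κ ω, f⟫_ℂ) ∂μ)
      (∫ ω, w ω * ⟪κ ω, α ω⟫_ℂ ∂μ) := by
  refine fun ι e => ⟨fun U => ?_, hasSum_integral_inner_mul_inner hw hα hκ hρ hle e⟩
  have hα' : ∀ g, AEStronglyMeasurable (fun ω => ⟪g, U.adjoint (α ω)⟫_ℂ) μ := fun g => by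
    simpa only [ContinuousLinearMap.adjoint_inner_right] using hα (U g)
  have := (hasSum_integral_inner_mul_inner hw hα' hκ (hρ.const_mul ‖U‖) ?_ e).summable
  · simpa only [ContinuousLinearMap.adjoint_inner_right] using this
  · filter_upwards [hle] with ω h
    have h1 : ‖U.adjoint (α ω)‖ ≤ ‖U‖ * ‖α ω‖ :=
      (U.adjoint.le_opNorm _).trans_eq (by simp)
    calc ‖w ω‖ * (‖U.adjoint (α ω)‖ * ‖κ ω‖) ≤ ‖w ω‖ * ((‖U‖ * ‖α ω‖) * ‖κ ω‖) := by gcongr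
      _ = ‖U‖ * (‖w ω‖ * (‖α ω‖ * ‖κ ω‖)) := by ring
      _ ≤ _ := by gcongr

theorem isNuclearForm_rankOne [CompleteSpace H] [TopologicalSpace.SeparableSpace H] (c : ℂ)
    (x y : H) : IsNuclearForm (fun g f => c * (⟪g, x⟫_ℂ * ⟪y, f⟫_ℂ)) (c * ⟪y, x⟫_ℂ) := by
  -- A Dirac mass on the one-point space reduces the integral to a single rank one term.
  have := isNuclearForm_integral (μ := Measure.dirac ()) (w := fun _ => c) (α := fun _ => x)
    (κ := fun _ => y) (ρ := fun _ => ‖c‖ * (‖x‖ * ‖y‖)) aestronglyMeasurable_const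
    (fun _ => aestronglyMeasurable_const) (fun _ => aestronglyMeasurable_const)
    (integrable_const _) (by simp)
  simpa using this

/-- The partial isometry of the polar decomposition recovers the modulus. -/
theorem exists_inner_abs_eq [CompleteSpace H] (T : H →L[ℂ] H) :
    ∃ U : H →L[ℂ] H, ∀ g f, ⟪g, CFC.abs T f⟫_ℂ = ⟪U g, T f⟫_ℂ := by
  set S := CFC.abs T with hS
  have hself : ∀ x y, ⟪S x, y⟫_ℂ = ⟪x, S y⟫_ℂ := by
    have h0 : IsSelfAdjoint S := (CFC.abs_nonneg T).isSelfAdjoint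
    intro x y
    rw [← ContinuousLinearMap.adjoint_inner_right, ← ContinuousLinearMap.star_eq_adjoint,
      h0.star_eq]
  have hinner : ∀ x y, ⟪S x, S y⟫_ℂ = ⟪T x, T y⟫_ℂ := by
    intro x y
    have h1 : S (S y) = (star T * T) y := by
      rw [← CFC.abs_mul_abs T]
      rfl
    rw [hself, h1, mul_apply_eq_comp, ContinuousLinearMap.star_eq_adjoint,
      ContinuousLinearMap.adjoint_inner_right]
  have hnorm : ∀ x, ‖T x‖ = ‖S x‖ := by
    intro x
    rw [@norm_eq_sqrt_re_inner ℂ, ← hinner, ← @norm_eq_sqrt_re_inner ℂ]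
  let K : Submodule ℂ H := S.range.topologicalClosure
  -- Since `‖T x‖ = ‖S x‖`, the assignment `S x ↦ T x` is well defined and isometric on the range of
  -- `S`; it extends to `V` on the closure `K`.
  let j : H →ₗ[ℂ] K := S.toLinearMap.codRestrict K fun x =>
    Submodule.le_topologicalClosure _ ⟨x, rfl⟩
  have hj : DenseRange j := by
    intro y
    rw [closure_subtype]
    have h2 : ((↑) : K → H) '' range j = range S := by
      rw [← range_comp]
      rfl
    rw [h2]
    exact y.2
  have hbound : ∀ x, ‖T.toLinearMap x‖ ≤ 1 * ‖j x‖ := fun x => by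
    rw [one_mul]
    exact (hnorm x).le
  let V : K →L[ℂ] H := T.toLinearMap.extendOfNorm j
  have hV : ∀ x, V (j x) = T x := LinearMap.extendOfNorm_eq hj ⟨1, hbound⟩
  have : CompleteSpace K := (Submodule.isClosed_topologicalClosure _).completeSpace_coe
  have hVinner : ∀ (y : K) (f : H), ⟪V y, T f⟫_ℂ = ⟪(y : H), S f⟫_ℂ := by
    intro y f
    refine congrFun (hj.equalizer (g := fun y : K => ⟪V y, T f⟫_ℂ)
      (h := fun y : K => ⟪(y : H), S f⟫_ℂ) (by fun_prop) (by fun_prop) ?_) y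
    ext x
    simp only [Function.comp_apply, hV]
    exact (hinner x f).symm
  -- Projecting `g` onto `K` does not change its inner product with `S f`, which lies in `K`.
  refine ⟨V ∘L K.orthogonalProjectionOnto, fun g f => ?_⟩
  rw [ContinuousLinearMap.comp_apply, hVinner]
  exact (Submodule.inner_orthogonalProjectionOnto_eq_of_mem_right (j f) g).symm

/-- With `|T| = U* T`, the diagonal sums of `|T|` are those of `β (U ·) ·`; this is why the
definition of a nuclear form allows an inserted operator. -/
theorem IsNuclearForm.isTraceClass [CompleteSpace H] {β : H → H → ℂ} {t : ℂ}
    (hβ : IsNuclearForm β t) {T : H →L[ℂ] H} (hT : ∀ g f, ⟪g, T f⟫_ℂ = β g f) :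
    IsTraceClass T := by
  obtain ⟨U, hU⟩ := exists_inner_abs_eq T
  intro ι e
  simp only [hU, hT]
  exact Complex.reCLM.summable ((hβ ι e).1 U)

theorem IsNuclearForm.hasTrace {β : H → H → ℂ} {t : ℂ}
    (hβ : IsNuclearForm β t) {T : H →L[ℂ] H} (hT : ∀ g f, ⟪g, T f⟫_ℂ = β g f) :
    HasTrace T t := by
  intro ι e
  simp only [hT]
  exact (hβ ι e).2

end NuclearForms

/-! ### Calculus of absolutely continuous functions on `[0,1]`. -/

section AbsoluteContinuity

variable {E F : Type*} [NormedAddCommGroup E] [NormedAddCommGroup F]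

theorem absolutelyContinuousOnInterval_of_dist_le {X Y : Type*} [PseudoMetricSpace X]
    [PseudoMetricSpace Y] {f : ℝ → X} {g : ℝ → Y} {a b K : ℝ}
    (hf : AbsolutelyContinuousOnInterval f a b)
    (h : ∀ x ∈ uIcc a b, ∀ y ∈ uIcc a b, dist (g x) (g y) ≤ K * dist (f x) (f y)) :
    AbsolutelyContinuousOnInterval g a b := by
  unfold AbsolutelyContinuousOnInterval at hf ⊢
  refine squeeze_zero' (.of_forall fun _ => Finset.sum_nonneg fun _ _ => dist_nonneg) ?_
    (by simpa using hf.const_mul K)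
  rw [Filter.eventually_inf_principal]
  filter_upwards with I hI
  rw [Finset.mul_sum]
  exact Finset.sum_le_sum fun i hi => h _ (hI.1 i hi).1 _ (hI.1 i hi).2

/-- Increments of the primitive of `v` are dominated by those of the primitive of the real function
`‖v‖`. -/
theorem absolutelyContinuousOnInterval_integral [NormedSpace ℝ E] {v : ℝ → E}
    (hv : IntegrableOn v (Icc (0 : ℝ) 1)) :
    AbsolutelyContinuousOnInterval (fun x => ∫ t in (0 : ℝ)..x, v t) 0 1 := by
  have hi : ∀ w : ℝ → E, IntegrableOn w (Icc (0 : ℝ) 1) → ∀ x ∈ Icc (0 : ℝ) 1,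
      IntervalIntegrable w volume 0 x := fun w hw x hx =>
    (intervalIntegrable_iff_integrableOn_Icc_of_le hx.1).2
      (hw.mono_set (Icc_subset_Icc_right hx.2))
  have hn : IntervalIntegrable (fun t => ‖v t‖) volume 0 1 := (hi v hv 1 (by simp)).norm
  refine absolutelyContinuousOnInterval_of_dist_le (K := 1)
    (hn.absolutelyContinuousOnInterval_intervalIntegral (c := 0) (by simp)) ?_
  rw [uIcc_of_le zero_le_one]
  intro x hx y hy
  rw [one_mul, dist_eq_norm, dist_eq_norm,
    intervalIntegral.integral_interval_sub_left (hi v hv x hx) (hi v hv y hy),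
    intervalIntegral.integral_interval_sub_left (hi v hv x hx).norm (hi v hv y hy).norm]
  exact intervalIntegral.norm_integral_le_abs_integral_norm

/-- `u` is absolutely continuous on `[0,1]`, with almost everywhere derivative `v ∈ L¹`. -/
structure HasACDeriv [NormedSpace ℝ E] (u v : ℝ → E) : Prop where
  ac : AbsolutelyContinuousOnInterval u 0 1
  integrable : IntegrableOn v (Icc (0 : ℝ) 1)
  ae_hasDerivAt : ∀ᵐ x ∂unitMeasure, HasDerivAt u (v x) x

namespace HasACDeriv

variable [NormedSpace ℝ E] [NormedSpace ℝ F] {u v u' v' : ℝ → E}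

theorem continuousOn (h : HasACDeriv u u') : ContinuousOn u (Icc 0 1) := by
  simpa [uIcc_of_le (zero_le_one' ℝ)] using h.ac.continuousOn

theorem congr_deriv (h : HasACDeriv u u') (huv : u' =ᵐ[unitMeasure] v') : HasACDeriv u v' where
  ac := h.ac
  integrable := h.integrable.congr huv
  ae_hasDerivAt := by
    filter_upwards [h.ae_hasDerivAt, huv] with x h1 h2
    exact h2 ▸ h1

theorem add (hu : HasACDeriv u u') (hv : HasACDeriv v v') :
    HasACDeriv (fun x => u x + v x) (fun x => u' x + v' x) where
  ac := hu.ac.add hv.ac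
  integrable := hu.integrable.add hv.integrable
  ae_hasDerivAt := by
    filter_upwards [hu.ae_hasDerivAt, hv.ae_hasDerivAt] with x h1 h2 using h1.add h2

theorem neg (hu : HasACDeriv u u') : HasACDeriv (fun x => -u x) (fun x => -u' x) where
  ac := hu.ac.neg
  integrable := hu.integrable.neg
  ae_hasDerivAt := by
    filter_upwards [hu.ae_hasDerivAt] with x h1 using h1.neg

theorem const (c : E) : HasACDeriv (fun _ => c) (fun _ => 0) where
  ac := ContDiffOn.absolutelyContinuousOnInterval contDiffOn_const
  integrable := integrable_zero _ _ _
  ae_hasDerivAt := .of_forall fun x => hasDerivAt_const x c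

theorem sum {ι : Type*} (s : Finset ι) {u u' : ι → ℝ → E} (h : ∀ i, HasACDeriv (u i) (u' i)) :
    HasACDeriv (fun x => ∑ i ∈ s, u i x) (fun x => ∑ i ∈ s, u' i x) := by
  classical
  induction s using Finset.induction_on with
  | empty => simpa using const (0 : E)
  | insert a s ha ih => simpa only [Finset.sum_insert ha] using (h a).add ih

theorem mul {u v u' v' : ℝ → ℂ} (hu : HasACDeriv u u') (hv : HasACDeriv v v') :
    HasACDeriv (fun x => u x * v x) (fun x => u' x * v x + u x * v' x) where
  ac := hu.ac.smul hv.ac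
  integrable := (hu.integrable.mul_continuousOn hv.continuousOn isCompact_Icc).add
    (hv.integrable.continuousOn_mul hu.continuousOn isCompact_Icc)
  ae_hasDerivAt := by
    filter_upwards [hu.ae_hasDerivAt, hv.ae_hasDerivAt] with x h1 h2 using h1.mul h2

theorem clm_comp (L : E →L[ℝ] F) (hu : HasACDeriv u u') :
    HasACDeriv (fun x => L (u x)) (fun x => L (u' x)) where
  ac := absolutelyContinuousOnInterval_of_dist_le hu.ac fun _ _ _ _ => L.dist_le_opNorm _ _
  integrable := L.integrable_comp hu.integrable
  ae_hasDerivAt := by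
    filter_upwards [hu.ae_hasDerivAt] with x h using L.hasFDerivAt.comp_hasDerivAt x h

/-- If `|p| ≤ C` on `[0,1]`, then `Real.exp` is Lipschitz with constant `exp C` on the values of
`p`. -/
theorem exp {p a : ℝ → ℝ} (h : HasACDeriv p a) :
    HasACDeriv (fun x => Real.exp (p x)) (fun x => Real.exp (p x) * a x) where
  ac := by
    obtain ⟨C, hC⟩ := h.ac.exists_bound
    refine absolutelyContinuousOnInterval_of_dist_le (K := Real.exp C) h.ac fun x hx y hy => ?_
    have key := (convex_Icc (-C) C).norm_image_sub_le_of_norm_deriv_le (f := Real.exp)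
      (C := Real.exp C) (fun t _ => Real.differentiableAt_exp) (fun t ht => by
        simpa using ht.2) (abs_le.1 (hC y hy)) (abs_le.1 (hC x hx))
    simpa only [dist_eq_norm] using key
  integrable := h.integrable.continuousOn_mul
    (Real.continuous_exp.comp_continuousOn h.continuousOn) isCompact_Icc
  ae_hasDerivAt := by
    filter_upwards [h.ae_hasDerivAt] with x hx using hx.exp

theorem intervalIntegrable (h : HasACDeriv u u') {x y : ℝ} (hx : x ∈ Icc (0 : ℝ) 1)
    (hy : y ∈ Icc (0 : ℝ) 1) : IntervalIntegrable u' volume x y :=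
  (h.integrable.mono_set (uIcc_subset_Icc hx hy)).intervalIntegrable

variable [CompleteSpace E]

theorem integral {v : ℝ → E} (hv : IntegrableOn v (Icc (0 : ℝ) 1)) :
    HasACDeriv (fun x => ∫ t in (0 : ℝ)..x, v t) v where
  ac := absolutelyContinuousOnInterval_integral hv
  integrable := hv
  ae_hasDerivAt := by
    rw [ae_restrict_iff' measurableSet_Icc]
    have := ((intervalIntegrable_iff_integrableOn_Icc_of_le
      (zero_le_one' ℝ)).2 hv).ae_hasDerivAt_integral
    filter_upwards [this] with x hx hx'
    exact hx (by simpa using hx') 0 (by simp)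

/-- Subtracting from `u` the primitive of `u'` leaves an absolutely continuous function whose
derivative vanishes almost everywhere, hence a constant. -/
theorem eq_add_integral (h : HasACDeriv u u') {x : ℝ} (hx : x ∈ Icc (0 : ℝ) 1) :
    u x = u 0 + ∫ t in (0 : ℝ)..x, u' t := by
  have h1 := h.add (integral h.integrable).neg
  have h2 : ∀ᵐ x, x ∈ uIcc (0 : ℝ) 1 → HasDerivAt (fun x => u x + -∫ t in (0 : ℝ)..x, u' t) 0 x := by
    rw [uIcc_of_le zero_le_one, ← ae_restrict_iff' measurableSet_Icc]
    filter_upwards [h1.ae_hasDerivAt] with x hx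
    simpa using hx
  obtain ⟨c, hc⟩ := h1.ac.const_of_ae_hasDerivAt_zero h2
  rw [uIcc_of_le zero_le_one] at hc
  have h3 := (hc x hx).trans (hc 0 (by simp)).symm
  simp only [intervalIntegral.integral_same, neg_zero, add_zero] at h3
  rw [← h3]
  abel

theorem sub_eq_integral (h : HasACDeriv u u') {x y : ℝ} (hx : x ∈ Icc (0 : ℝ) 1)
    (hy : y ∈ Icc (0 : ℝ) 1) : u y - u x = ∫ t in x..y, u' t := by
  rw [h.eq_add_integral hx, h.eq_add_integral hy, add_sub_add_left_eq_sub,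
    intervalIntegral.integral_interval_sub_left (h.intervalIntegrable (by simp) hy)
      (h.intervalIntegrable (by simp) hx)]

end HasACDeriv

/-! ### Linear differential equations with integrable coefficients. -/

section LinearODE

variable [NormedSpace ℝ E]

theorem integrableOn_clm_apply {A : ℝ → E →L[ℝ] E} (hA : IntegrableOn A (Icc (0 : ℝ) 1))
    {y : ℝ → E} (hy : ContinuousOn y (Icc 0 1)) :
    IntegrableOn (fun x => A x (y x)) (Icc (0 : ℝ) 1) := by
  obtain ⟨C, hC⟩ := isCompact_Icc.exists_bound_of_continuousOn hy
  refine (hA.norm.mul_const C).mono' ?_ ?_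
  · exact isBoundedBilinearMap_apply.continuous.comp_aestronglyMeasurable
      (hA.aestronglyMeasurable.prodMk
        (hy.aestronglyMeasurable_of_isCompact isCompact_Icc measurableSet_Icc))
  · filter_upwards [ae_restrict_mem measurableSet_Icc] with x hx
    exact ((A x).le_opNorm _).trans (by gcongr; exact hC x hx)

/-- Linear differential equations with integrable coefficients are solvable: the weight
`exp (-2 ∫₀ˣ ‖A‖)` turns the integral equation into a contraction. -/
theorem exists_hasACDeriv_clm_apply [CompleteSpace E] {A : ℝ → E →L[ℝ] E}
    (hA : IntegrableOn A (Icc (0 : ℝ) 1)) (c : E) :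
    ∃ u : ℝ → E, HasACDeriv u (fun x => A x (u x)) ∧ u 0 = c := by
  let p : ℝ → ℝ := fun x => ∫ t in (0 : ℝ)..x, 2 * ‖A t‖
  have hp : HasACDeriv p (fun t => 2 * ‖A t‖) := .integral (hA.norm.const_mul 2)
  have hexp : ContinuousOn (fun x => Real.exp (p x)) (Icc 0 1) := hp.exp.continuousOn
  let ext : C(Icc (0 : ℝ) 1, E) → ℝ → E := fun ψ => IccExtend zero_le_one ψ
  have hext : ∀ ψ, Continuous (ext ψ) := fun ψ => ψ.continuous.Icc_extend'
  -- Here `ψ` stands for `exp (-p) • u`, so the integrand is `A u`, and the sup norm of `ψ` is the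
  -- weighted norm of `u`.
  let integrand : C(Icc (0 : ℝ) 1, E) → ℝ → E := fun ψ s => A s (Real.exp (p s) • ext ψ s)
  have hint : ∀ ψ, IntegrableOn (integrand ψ) (Icc (0 : ℝ) 1) := fun ψ =>
    integrableOn_clm_apply hA (hexp.smul (hext ψ).continuousOn)
  have hcont : ∀ ψ, ContinuousOn
      (fun x => Real.exp (-p x) • (c + ∫ s in (0 : ℝ)..x, integrand ψ s)) (Icc 0 1) := fun ψ =>
    (Real.continuous_exp.comp_continuousOn hp.continuousOn.neg).smul
      (continuousOn_const.add (HasACDeriv.integral (hint ψ)).continuousOn)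
  let G : C(Icc (0 : ℝ) 1, E) → C(Icc (0 : ℝ) 1, E) := fun ψ => ⟨_, (hcont ψ).domRestrict⟩
  have hG : ContractingWith (1 / 2) G := by
    refine ⟨by norm_num, LipschitzWith.of_dist_le_mul fun ψ χ => ?_⟩
    rw [ContinuousMap.dist_le (by positivity)]
    intro x
    have hx := x.2
    have hi : ∀ ψ, IntervalIntegrable (integrand ψ) volume 0 x := fun ψ =>
      (HasACDeriv.integral (hint ψ)).intervalIntegrable (by simp) hx
    have h1 : dist (G ψ x) (G χ x) =
        Real.exp (-p x) * ‖∫ s in (0 : ℝ)..x, (integrand ψ s - integrand χ s)‖ := by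
      rw [intervalIntegral.integral_sub (hi ψ) (hi χ)]
      change dist (Real.exp (-p x) • (c + _)) (Real.exp (-p x) • (c + _)) = _
      rw [dist_eq_norm, ← smul_sub, add_sub_add_left_eq_sub, norm_smul, Real.norm_eq_abs,
        Real.abs_exp]
    have h2 : ‖∫ s in (0 : ℝ)..x, (integrand ψ s - integrand χ s)‖ ≤
        ∫ s in (0 : ℝ)..x, (Real.exp (p s) * (2 * ‖A s‖)) * (dist ψ χ / 2) := by
      refine intervalIntegral.norm_integral_le_of_norm_le hx.1 (.of_forall fun s hs => ?_)
        ((hp.exp.intervalIntegrable (by simp) hx).mul_const _)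
      have h3 : ‖ext ψ s - ext χ s‖ ≤ dist ψ χ := by
        rw [← dist_eq_norm]
        exact ContinuousMap.dist_apply_le_dist _
      calc ‖integrand ψ s - integrand χ s‖
          = ‖A s (Real.exp (p s) • (ext ψ s - ext χ s))‖ := by
            simp only [integrand, smul_sub, map_sub]
        _ ≤ ‖A s‖ * (Real.exp (p s) * dist ψ χ) := by
            refine ((A s).le_opNorm _).trans ?_
            rw [norm_smul, Real.norm_eq_abs, Real.abs_exp]
            gcongr
        _ = _ := by ring
    -- The factor `exp (p s) * (2 * ‖A s‖)` is the derivative of `exp ∘ p`, with integral `exp (p x)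
    -- - 1`; times `exp (-p x)` this is below 1. The 2 in `p` accounts for the contraction constant
    -- `1/2`.
    rw [intervalIntegral.integral_mul_const, ← hp.exp.sub_eq_integral (by simp) hx] at h2
    have hp0 : p 0 = 0 := intervalIntegral.integral_same
    rw [hp0, Real.exp_zero] at h2
    rw [h1]
    calc _ ≤ Real.exp (-p x) * ((Real.exp (p x) - 1) * (dist ψ χ / 2)) := by gcongr
      _ = (1 - Real.exp (-p x)) * (dist ψ χ / 2) := by
        rw [← mul_assoc, mul_sub, ← Real.exp_add]
        simp
      _ ≤ 1 * (dist ψ χ / 2) := by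
        gcongr
        linarith [Real.exp_pos (-p x)]
      _ = _ := by
        push_cast
        ring
  let ψ := ContractingWith.fixedPoint G hG
  have hψ : G ψ = ψ := hG.fixedPoint_isFixedPt
  have hsol : ∀ x ∈ Icc (0 : ℝ) 1,
      Real.exp (p x) • ext ψ x = c + ∫ s in (0 : ℝ)..x, integrand ψ s := by
    intro x hx
    have h4 : ext ψ x = G ψ ⟨x, hx⟩ := by
      rw [hψ]
      exact IccExtend_of_mem _ _ hx
    rw [h4]
    change Real.exp (p x) • (Real.exp (-p x) • (_ : E)) = _
    rw [smul_smul, ← Real.exp_add]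
    simp
  refine ⟨fun x => c + ∫ s in (0 : ℝ)..x, integrand ψ s, ?_, by simp⟩
  refine HasACDeriv.congr_deriv
    (by simpa using (HasACDeriv.const c).add (HasACDeriv.integral (hint ψ))) ?_
  filter_upwards [ae_restrict_mem measurableSet_Icc] with x hx
  rw [← hsol x hx]

end LinearODE

end AbsoluteContinuity

/-! ### Fundamental matrices, variation of constants, and differences of Volterra terms. -/

section MatrixODE

variable {n : ℕ}

/-- Entrywise absolutely continuous matrix functions with derivative in `L¹`. -/
def HasMatDeriv (Y Y' : ℝ → Matrix (Fin n) (Fin n) ℂ) : Prop :=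
  ∀ i j, HasACDeriv (fun x => Y x i j) (fun x => Y' x i j)

/-- Coordinatewise absolutely continuous vector functions with derivative in `L¹`. -/
def HasVecDeriv (u u' : ℝ → Fin n → ℂ) : Prop :=
  ∀ i, HasACDeriv (fun x => u x i) (fun x => u' x i)

theorem HasMatDeriv.mul {Y Y' Z Z' : ℝ → Matrix (Fin n) (Fin n) ℂ} (hY : HasMatDeriv Y Y')
    (hZ : HasMatDeriv Z Z') :
    HasMatDeriv (fun x => Y x * Z x) (fun x => Y' x * Z x + Y x * Z' x) := by
  intro i j
  simpa only [Matrix.mul_apply, Matrix.add_apply, Finset.sum_add_distrib] using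
    HasACDeriv.sum Finset.univ fun k => (hY i k).mul (hZ k j)

theorem HasMatDeriv.mulVec {Y Y' : ℝ → Matrix (Fin n) (Fin n) ℂ} {u u' : ℝ → Fin n → ℂ}
    (hY : HasMatDeriv Y Y') (hu : HasVecDeriv u u') :
    HasVecDeriv (fun x => Y x *ᵥ u x) (fun x => Y' x *ᵥ u x + Y x *ᵥ u' x) := by
  intro i
  simpa only [Matrix.mulVec, dotProduct, Pi.add_apply, Finset.sum_add_distrib] using
    HasACDeriv.sum Finset.univ fun k => (hY i k).mul (hu k)

theorem HasMatDeriv.continuousOn {Y Y' : ℝ → Matrix (Fin n) (Fin n) ℂ} (hY : HasMatDeriv Y Y') :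
    ContinuousOn Y (Icc 0 1) :=
  continuousOn_pi.2 fun i => continuousOn_pi.2 fun j => (hY i j).continuousOn

theorem HasACDeriv.hasVecDeriv {u u' : ℝ → Cn n} (h : HasACDeriv u u') :
    HasVecDeriv (fun x => (u x).ofLp) (fun x => (u' x).ofLp) := fun i =>
  h.clm_comp ((EuclideanSpace.proj i : Cn n →L[ℂ] ℂ).restrictScalars ℝ)

/-- Matrices acting on `ℂⁿ`, as a real linear map into the continuous real endomorphisms. -/
noncomputable def matrixAction (n : ℕ) :
    (Fin n → Fin n → ℂ) →ₗ[ℝ] (Cn n →L[ℝ] Cn n) where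
  toFun M := LinearMap.toContinuousLinearMap
    { toFun := fun y => WithLp.toLp 2 (Matrix.of M *ᵥ y.ofLp)
      map_add' := fun y y' => by simp [Matrix.mulVec_add]
      map_smul' := fun c y => by simp [Matrix.mulVec_smul] }
  map_add' M M' := by
    ext y i
    simp [Matrix.mulVec, dotProduct, add_mul, Finset.sum_add_distrib]
  map_smul' c M := by
    ext y i
    simp [Matrix.mulVec, dotProduct, Finset.mul_sum, mul_assoc]

theorem exists_hasACDeriv_mulVec {M : ℝ → Matrix (Fin n) (Fin n) ℂ} (hM : IsL1Potential M)
    (c : Cn n) :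
    ∃ u : ℝ → Cn n, HasACDeriv u (fun x => WithLp.toLp 2 (M x *ᵥ (u x).ofLp)) ∧ u 0 = c := by
  have hpi : Integrable (fun x j k => M x j k) unitMeasure :=
    Integrable.of_eval fun j => Integrable.of_eval fun k => hM j k
  exact exists_hasACDeriv_clm_apply
    ((LinearMap.toContinuousLinearMap (matrixAction n)).integrable_comp hpi) c

theorem exists_matrix_solution {M : ℝ → Matrix (Fin n) (Fin n) ℂ} (hM : IsL1Potential M) :
    ∃ Y : ℝ → Matrix (Fin n) (Fin n) ℂ, Y 0 = 1 ∧
      ∀ k, HasACDeriv (fun x => (WithLp.toLp 2 ((Y x).col k) : Cn n))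
        (fun x => WithLp.toLp 2 (M x *ᵥ (Y x).col k)) := by
  choose u hu hu0 using fun k : Fin n =>
    exists_hasACDeriv_mulVec hM (EuclideanSpace.single k (1 : ℂ))
  refine ⟨fun x => Matrix.of fun j k => u k x j, ?_, hu⟩
  ext j k
  simp [hu0, Matrix.one_apply, PiLp.single_apply]

theorem hasMatDeriv_of_col {M Y : ℝ → Matrix (Fin n) (Fin n) ℂ}
    (h : ∀ k, HasACDeriv (fun x => (WithLp.toLp 2 ((Y x).col k) : Cn n))
      (fun x => WithLp.toLp 2 (M x *ᵥ (Y x).col k))) :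
    HasMatDeriv Y (fun x => M x * Y x) := fun i j => (h j).hasVecDeriv i

/-- `Φ` is the fundamental matrix of `y' = A y` normalized at `0`, and `Ψ` its inverse. -/
structure IsFundamentalPair (A Φ Ψ : ℝ → Matrix (Fin n) (Fin n) ℂ) : Prop where
  zero : Φ 0 = 1
  left : HasMatDeriv Φ (fun x => A x * Φ x)
  right : HasMatDeriv Ψ (fun x => -(Ψ x * A x))
  inv : ∀ x ∈ Icc (0 : ℝ) 1, Ψ x * Φ x = 1

/-- The inverse is built as the transpose of a solution of the adjoint system `Y' = -Aᵀ Y`. Then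
`(ΨΦ)' = -ΨAΦ + ΨAΦ = 0`, so `ΨΦ` keeps its initial value 1. -/
theorem exists_isFundamentalPair {A Φ : ℝ → Matrix (Fin n) (Fin n) ℂ} (hA : IsL1Potential A)
    (h0 : Φ 0 = 1) (hΦ : HasMatDeriv Φ (fun x => A x * Φ x)) : ∃ Ψ, IsFundamentalPair A Φ Ψ := by
  obtain ⟨Y, hY0, hY⟩ := exists_matrix_solution (M := fun x => -(A x)ᵀ) fun j k => (hA k j).neg
  have hΨ : HasMatDeriv (fun x => (Y x)ᵀ) (fun x => -((Y x)ᵀ * A x)) := by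
    intro i j
    have hs := hasMatDeriv_of_col hY j i
    have he : ∀ x, (-(A x)ᵀ * Y x) j i = (-((Y x)ᵀ * A x)) i j := fun x => by
      simp [Matrix.mul_apply, mul_comm]
    simpa only [he, Matrix.transpose_apply] using hs
  refine ⟨fun x => (Y x)ᵀ, h0, hΦ, hΨ, fun x hx => ?_⟩
  ext i j
  refine (((hΨ.mul hΦ) i j).eq_add_integral hx).trans ?_
  simp [hY0, h0, Matrix.mul_assoc]

namespace IsFundamentalPair

variable {A Φ Ψ : ℝ → Matrix (Fin n) (Fin n) ℂ}

theorem mul_eq_one (P : IsFundamentalPair A Φ Ψ) {x : ℝ} (hx : x ∈ Icc (0 : ℝ) 1) :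
    Φ x * Ψ x = 1 :=
  mul_eq_one_comm.1 (P.inv x hx)

theorem inv_eq (P : IsFundamentalPair A Φ Ψ) {x : ℝ} (hx : x ∈ Icc (0 : ℝ) 1) :
    (Φ x)⁻¹ = Ψ x :=
  Matrix.inv_eq_left_inv (P.inv x hx)

theorem isUnit (P : IsFundamentalPair A Φ Ψ) {x : ℝ} (hx : x ∈ Icc (0 : ℝ) 1) : IsUnit (Φ x) :=
  IsUnit.of_mul_eq_one_right _ (P.inv x hx)

end IsFundamentalPair

/-- The vector `∫ₓ¹ Ψ h dt`. -/
noncomputable def tailIntegral (Ψ : ℝ → Matrix (Fin n) (Fin n) ℂ) (h : ℝ → Fin n → ℂ) (x : ℝ) :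
    Fin n → ℂ :=
  fun l => ∫ t in x..1, (Ψ t *ᵥ h t) l

theorem integrableOn_mulVec {Ψ : ℝ → Matrix (Fin n) (Fin n) ℂ} {h : ℝ → Fin n → ℂ}
    (hΨ : ContinuousOn Ψ (Icc 0 1)) (hh : ∀ j, IntegrableOn (fun x => h x j) (Icc (0 : ℝ) 1))
    (i : Fin n) : IntegrableOn (fun x => (Ψ x *ᵥ h x) i) (Icc (0 : ℝ) 1) :=
  integrable_finsetSum Finset.univ fun j _ => (hh j).continuousOn_mul
    (continuousOn_pi.1 (continuousOn_pi.1 hΨ i) j) isCompact_Icc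

theorem integrableOn_mulVec_of_isL1Potential {w : ℝ → Matrix (Fin n) (Fin n) ℂ} {h : ℝ → Fin n → ℂ}
    (hw : IsL1Potential w) (hh : ∀ j, ContinuousOn (fun x => h x j) (Icc (0 : ℝ) 1))
    (i : Fin n) : IntegrableOn (fun x => (w x *ᵥ h x) i) (Icc (0 : ℝ) 1) :=
  integrable_finsetSum Finset.univ fun j _ => (hw i j).mul_continuousOn (hh j) isCompact_Icc

theorem hasVecDeriv_tailIntegral {Ψ : ℝ → Matrix (Fin n) (Fin n) ℂ} {h : ℝ → Fin n → ℂ}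
    (hΨ : ContinuousOn Ψ (Icc 0 1)) (hh : ∀ j, IntegrableOn (fun x => h x j) (Icc (0 : ℝ) 1)) :
    HasVecDeriv (tailIntegral Ψ h) (fun x => -(Ψ x *ᵥ h x)) := by
  intro l
  have hi := integrableOn_mulVec hΨ hh l
  have key := (HasACDeriv.const (∫ t in (0 : ℝ)..1, (Ψ t *ᵥ h t) l)).add
    (HasACDeriv.integral hi).neg
  have heq : EqOn (fun x => tailIntegral Ψ h x l)
      (fun x => (∫ t in (0 : ℝ)..1, (Ψ t *ᵥ h t) l) + -∫ t in (0 : ℝ)..x, (Ψ t *ᵥ h t) l)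
      (Icc 0 1) := fun x hx => by
    have := intervalIntegral.integral_interval_sub_left
      ((HasACDeriv.integral hi).intervalIntegrable (x := 0) (y := 1) (by simp) (by simp))
      ((HasACDeriv.integral hi).intervalIntegrable (x := 0) (by simp) hx)
    simp only [tailIntegral]
    rw [← this, sub_eq_add_neg]
  refine ⟨absolutelyContinuousOnInterval_of_dist_le (K := 1) key.ac fun x hx y hy => ?_, hi.neg, ?_⟩
  · rw [uIcc_of_le zero_le_one] at hx hy
    rw [one_mul]
    exact (congrArg₂ dist (heq hx) (heq hy)).le
  -- The two functions agree only on `[0,1]`, so derivatives are compared at interior points; the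
  -- endpoints are a null set.
  · have hIoo : ∀ᵐ x ∂unitMeasure, x ∈ Ioo (0 : ℝ) 1 := by
      rw [unitMeasure, ← restrict_Ioo_eq_restrict_Icc]
      exact ae_restrict_mem measurableSet_Ioo
    filter_upwards [key.ae_hasDerivAt, hIoo] with x hd hx
    have hnhds : Icc (0 : ℝ) 1 ∈ nhds x := Icc_mem_nhds hx.1 hx.2
    simpa using hd.congr_of_eventuallyEq (heq.eventuallyEq_of_mem hnhds)

namespace IsFundamentalPair

variable {A Φ Ψ : ℝ → Matrix (Fin n) (Fin n) ℂ}

/-- Variation of constants, with a two-point boundary condition. -/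
theorem eq_of_boundary (P : IsFundamentalPair A Φ Ψ) {C D M : Matrix (Fin n) (Fin n) ℂ}
    (hM : M * (C + D * Φ 1) = 1) {u h : ℝ → Fin n → ℂ}
    (hu : HasVecDeriv u (fun x => A x *ᵥ u x + h x)) (hbc : C *ᵥ u 0 + D *ᵥ u 1 = 0) {x : ℝ}
    (hx : x ∈ Icc (0 : ℝ) 1) :
    u x = Φ x *ᵥ ((M * C) *ᵥ tailIntegral Ψ h 0 - tailIntegral Ψ h x) := by
  -- The terms with `A` cancel: `(Ψu)' = -ΨAu + Ψ(Au + h)`.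
  have hd : HasVecDeriv (fun x => Ψ x *ᵥ u x) (fun x => Ψ x *ᵥ h x) := by
    have := P.right.mulVec hu
    simpa only [Matrix.mulVec_add, Matrix.neg_mulVec, Matrix.mulVec_mulVec,
      neg_add_cancel_left] using this
  have hsub : ∀ x ∈ Icc (0 : ℝ) 1, Ψ x *ᵥ u x = Ψ 1 *ᵥ u 1 - tailIntegral Ψ h x := by
    intro x hx
    ext l
    have := (hd l).sub_eq_integral hx (y := 1) (by simp)
    simp only [Pi.sub_apply, tailIntegral, ← this]
    ring
  have hΦ : ∀ x ∈ Icc (0 : ℝ) 1, u x = Φ x *ᵥ (Ψ 1 *ᵥ u 1 - tailIntegral Ψ h x) := by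
    intro x hx
    rw [← hsub x hx, Matrix.mulVec_mulVec, P.mul_eq_one hx, Matrix.one_mulVec]
  have h0 : u 0 = Ψ 1 *ᵥ u 1 - tailIntegral Ψ h 0 := by
    simpa [P.zero] using hΦ 0 (by simp)
  have h1 : u 1 = Φ 1 *ᵥ (Ψ 1 *ᵥ u 1) := by
    rw [Matrix.mulVec_mulVec, P.mul_eq_one (by simp), Matrix.one_mulVec]
  -- The unknown is `q = Ψ(1)u(1)`. As `u(1) = Φ(1)q` and `u(0) = q - ∫₀¹ Ψh`, the boundary
  -- condition becomes a linear equation for `q`.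
  have hq : (C + D * Φ 1) *ᵥ (Ψ 1 *ᵥ u 1) = C *ᵥ tailIntegral Ψ h 0 := by
    have h2 := hbc
    rw [h0, Matrix.mulVec_sub] at h2
    nth_rewrite 2 [h1] at h2
    rw [Matrix.add_mulVec, ← Matrix.mulVec_mulVec _ D]
    rw [sub_add_eq_add_sub, sub_eq_zero] at h2
    exact h2
  rw [hΦ x hx, ← Matrix.mulVec_mulVec _ M, ← hq, Matrix.mulVec_mulVec _ M, hM, Matrix.one_mulVec]

end IsFundamentalPair

/-- The difference of two Volterra resolvents, as in the second resolvent identity. -/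
theorem mulVec_tailIntegral_sub {A₁ A₂ Φ₁ Φ₂ Ψ₁ Ψ₂ : ℝ → Matrix (Fin n) (Fin n) ℂ}
    (P₁ : IsFundamentalPair A₁ Φ₁ Ψ₁) (P₂ : IsFundamentalPair A₂ Φ₂ Ψ₂) {h : ℝ → Fin n → ℂ}
    (hh : ∀ j, IntegrableOn (fun x => h x j) (Icc (0 : ℝ) 1)) {x : ℝ} (hx : x ∈ Icc (0 : ℝ) 1) :
    Φ₁ x *ᵥ tailIntegral Ψ₁ h x - Φ₂ x *ᵥ tailIntegral Ψ₂ h x =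
      Φ₁ x *ᵥ tailIntegral (fun s => Ψ₁ s * (A₂ s - A₁ s) * Φ₂ s) (tailIntegral Ψ₂ h) x := by
  have hN : HasMatDeriv (fun x => Ψ₁ x * Φ₂ x) (fun s => Ψ₁ s * (A₂ s - A₁ s) * Φ₂ s) := by
    have := P₁.right.mul P₂.left
    have he : ∀ s, -(Ψ₁ s * A₁ s) * Φ₂ s + Ψ₁ s * (A₂ s * Φ₂ s) =
        Ψ₁ s * (A₂ s - A₁ s) * Φ₂ s := fun s => by noncomm_ring
    simpa only [he] using this
  have hT := hasVecDeriv_tailIntegral P₂.right.continuousOn hh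
  have hd := hN.mulVec hT
  -- Integration by parts on `[x,1]`: the product of `Ψ₁Φ₂` with the tail of `Ψ₂h` vanishes at 1,
  -- and `Ψ₁Φ₂Ψ₂h = Ψ₁h`.
  have key : tailIntegral (fun s => Ψ₁ s * (A₂ s - A₁ s) * Φ₂ s) (tailIntegral Ψ₂ h) x =
      tailIntegral Ψ₁ h x - (Ψ₁ x * Φ₂ x) *ᵥ tailIntegral Ψ₂ h x := by
    ext l
    have h1 := (hd l).sub_eq_integral hx (y := 1) (by simp)
    have hw := integrableOn_mulVec_of_isL1Potential (fun i j => (hN i j).integrable)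
      (fun j => (hT j).continuousOn) l
    have hΨ := integrableOn_mulVec P₁.right.continuousOn hh l
    have h2 : ∫ t in x..1, ((Ψ₁ t * (A₂ t - A₁ t) * Φ₂ t) *ᵥ tailIntegral Ψ₂ h t +
          (Ψ₁ t * Φ₂ t) *ᵥ -(Ψ₂ t *ᵥ h t)) l =
        ∫ t in x..1, (((Ψ₁ t * (A₂ t - A₁ t) * Φ₂ t) *ᵥ tailIntegral Ψ₂ h t) l -
          (Ψ₁ t *ᵥ h t) l) := by
      refine intervalIntegral.integral_congr fun t ht => ?_
      have ht' : t ∈ Icc (0 : ℝ) 1 := uIcc_subset_Icc hx (by simp) ht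
      simp only [Pi.add_apply, Matrix.mulVec_neg, Pi.neg_apply, sub_eq_add_neg]
      rw [Matrix.mulVec_mulVec, Matrix.mul_assoc (Ψ₁ t) (Φ₂ t), P₂.mul_eq_one ht', Matrix.mul_one]
    rw [h2, intervalIntegral.integral_sub
      ((HasACDeriv.integral hw).intervalIntegrable hx (by simp))
      ((HasACDeriv.integral hΨ).intervalIntegrable hx (by simp))] at h1
    have h3 : tailIntegral Ψ₂ h 1 = 0 := by
      ext l
      simp [tailIntegral]
    simp only [h3, Matrix.mulVec_zero, Pi.zero_apply, zero_sub] at h1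
    simp only [Pi.sub_apply]
    simp only [tailIntegral] at h1 ⊢
    linear_combination -h1
  rw [key, Matrix.mulVec_sub, Matrix.mulVec_mulVec, ← Matrix.mul_assoc, P₁.mul_eq_one hx,
    Matrix.one_mul]

end MatrixODE

/-! ### The boundary value problem as a first order system, and its resolvent. -/

section BoundaryValueProblem

variable {n : ℕ}

theorem IsW11.hasACDeriv {u : ℝ → Cn n} (hu : IsW11 u) : HasACDeriv u (deriv u) where
  ac := hu.1
  integrable := hu.2
  ae_hasDerivAt := by
    filter_upwards [hu.ae_differentiableAt] with x hx using hx.hasDerivAt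

theorem HasACDeriv.ae_deriv_eq {u v : ℝ → Cn n} (hu : HasACDeriv u v) :
    deriv u =ᵐ[unitMeasure] v := by
  filter_upwards [hu.ae_hasDerivAt] with x hx using hx.deriv

theorem HasACDeriv.isW11 {u v : ℝ → Cn n} (hu : HasACDeriv u v) : IsW11 u :=
  ⟨hu.ac, hu.integrable.congr hu.ae_deriv_eq.symm⟩

/-- The coefficient matrix of `L(Q)y = z y`, solved for the derivative. -/
noncomputable def coeffMatrix (b : Fin n → ℂ) (Q : ℝ → Matrix (Fin n) (Fin n) ℂ) (z : ℂ) (x : ℝ) :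
    Matrix (Fin n) (Fin n) ℂ :=
  Matrix.diagonal (fun j => Complex.I * b j) * (z • (1 : Matrix (Fin n) (Fin n) ℂ) - Q x)

theorem isL1Potential_coeffMatrix {Q : ℝ → Matrix (Fin n) (Fin n) ℂ} (b : Fin n → ℂ)
    (hQ : IsL1Potential Q) (z : ℂ) : IsL1Potential (coeffMatrix b Q z) := by
  intro j k
  simp only [coeffMatrix, Matrix.diagonal_mul, Matrix.sub_apply]
  exact (Integrable.sub (integrable_const _) (hQ j k)).const_mul _

theorem diffExpr_apply {b : Fin n → ℂ} (hb : ∀ j, b j ≠ 0) (Q : ℝ → Matrix (Fin n) (Fin n) ℂ)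
    (u : ℝ → Cn n) (x : ℝ) (j : Fin n) :
    diffExpr b Q u x j = -Complex.I * ((b j)⁻¹ * deriv u x j) + (Q x *ᵥ (u x).ofLp) j := by
  have hinv : (Matrix.diagonal b)⁻¹ = Matrix.diagonal fun j => (b j)⁻¹ := by
    refine Matrix.inv_eq_right_inv ?_
    rw [Matrix.diagonal_mul_diagonal, ← Matrix.diagonal_one]
    congr 1
    ext j
    exact mul_inv_cancel₀ (hb j)
  simp [diffExpr, hinv, Matrix.mulVec_diagonal]

theorem coeffMatrix_mulVec_apply (b : Fin n → ℂ) (Q : ℝ → Matrix (Fin n) (Fin n) ℂ) (z : ℂ)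
    (x : ℝ) (y : Fin n → ℂ) (j : Fin n) :
    (coeffMatrix b Q z x *ᵥ y) j = Complex.I * b j * (z * y j - (Q x *ᵥ y) j) := by
  rw [coeffMatrix, ← Matrix.mulVec_mulVec, Matrix.mulVec_diagonal, Matrix.sub_mulVec,
    Matrix.smul_mulVec, Matrix.one_mulVec]
  simp

theorem diffExpr_eq_iff {b : Fin n → ℂ} (hb : ∀ j, b j ≠ 0) (Q : ℝ → Matrix (Fin n) (Fin n) ℂ)
    (z : ℂ) (u : ℝ → Cn n) (x : ℝ) (f : Cn n) :
    diffExpr b Q u x = z • u x + f ↔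
      (deriv u x).ofLp = coeffMatrix b Q z x *ᵥ (u x).ofLp + fun j => Complex.I * b j * f j := by
  have key : ∀ j, diffExpr b Q u x j = (z • u x + f) j ↔ (deriv u x).ofLp j =
      (coeffMatrix b Q z x *ᵥ (u x).ofLp + fun j => Complex.I * b j * f j) j := by
    intro j
    rw [diffExpr_apply hb, Pi.add_apply, coeffMatrix_mulVec_apply]
    simp only [PiLp.add_apply, PiLp.smul_apply, smul_eq_mul]
    have hbj := hb j
    have hI := Complex.I_sq
    constructor <;> intro h
    · have h' : (b j)⁻¹ * deriv u x j = Complex.I * (z * u x j + f j - (Q x *ᵥ (u x).ofLp) j) := by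
        linear_combination Complex.I * h + (b j)⁻¹ * deriv u x j * hI
      rw [show deriv u x j = b j * ((b j)⁻¹ * deriv u x j) by field_simp, h']
      ring
    · rw [h]
      field_simp
      linear_combination (-(z * u x j - (Q x *ᵥ (u x).ofLp) j) - f j) * hI
  constructor
  · intro h
    ext j
    exact (key j).1 (by rw [h])
  · intro h
    ext j
    exact (key j).2 (by rw [h])

theorem IsW11.hasVecDeriv_of_diffExpr {b : Fin n → ℂ} (hb : ∀ j, b j ≠ 0)
    {Q : ℝ → Matrix (Fin n) (Fin n) ℂ} {z : ℂ} {u f : ℝ → Cn n} (hu : IsW11 u)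
    (h : ∀ᵐ x ∂unitMeasure, diffExpr b Q u x = z • u x + f x) :
    HasVecDeriv (fun x => (u x).ofLp)
      (fun x => coeffMatrix b Q z x *ᵥ (u x).ofLp + fun j => Complex.I * b j * f x j) := by
  intro j
  refine (hu.hasACDeriv.hasVecDeriv j).congr_deriv ?_
  filter_upwards [h] with x hx
  exact congrFun ((diffExpr_eq_iff hb Q z u x (f x)).1 hx) j

theorem exists_isFundamentalMatrix {b : Fin n → ℂ} (hb : ∀ j, b j ≠ 0)
    {Q : ℝ → Matrix (Fin n) (Fin n) ℂ} (hQ : IsL1Potential Q) (z : ℂ) :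
    ∃ Φ, IsFundamentalMatrix b Q z Φ := by
  obtain ⟨Y, hY0, hY⟩ := exists_matrix_solution (isL1Potential_coeffMatrix b hQ z)
  refine ⟨Y, hY0, fun k => ⟨(hY k).isW11, ?_⟩⟩
  filter_upwards [(hY k).ae_deriv_eq] with x hx
  have := (diffExpr_eq_iff hb Q z (fun t => WithLp.toLp 2 ((Y t).col k)) x 0).2 (by
    rw [hx]
    ext j
    simp)
  simpa using this

theorem IsFundamentalMatrix.exists_isFundamentalPair {b : Fin n → ℂ} (hb : ∀ j, b j ≠ 0)
    {Q Φ : ℝ → Matrix (Fin n) (Fin n) ℂ} (hQ : IsL1Potential Q) {z : ℂ}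
    (hΦ : IsFundamentalMatrix b Q z Φ) : ∃ Ψ, IsFundamentalPair (coeffMatrix b Q z) Φ Ψ := by
  refine DiracBVP.exists_isFundamentalPair (isL1Potential_coeffMatrix b hQ z) hΦ.1 fun i j => ?_
  have := (hΦ.2 j).1.hasVecDeriv_of_diffExpr hb (f := fun _ => 0) (z := z) (Q := Q) (by
    filter_upwards [(hΦ.2 j).2] with x hx
    rw [hx, add_zero]) i
  simpa using! this

theorem memLp_of_continuousOn {u : ℝ → Cn n} (hu : ContinuousOn u (Icc 0 1)) :
    MemLp u 2 unitMeasure := by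
  obtain ⟨K, hK⟩ := isCompact_Icc.exists_bound_of_continuousOn hu
  refine MemLp.of_bound (hu.aestronglyMeasurable_of_isCompact isCompact_Icc measurableSet_Icc) K ?_
  filter_upwards [ae_restrict_mem measurableSet_Icc] with x hx using hK x hx

/-- Off the spectrum the homogeneous boundary value problem has only the zero solution. -/
theorem eq_zero_of_boundary {b : Fin n → ℂ} {Q : ℝ → Matrix (Fin n) (Fin n) ℂ}
    {C D : Matrix (Fin n) (Fin n) ℂ} {z : ℂ} (hz : z ∈ resolventSetOf (bvpOperator b Q C D))
    {u : ℝ → Cn n} (hu : IsW11 u) (hde : ∀ᵐ x ∂unitMeasure, diffExpr b Q u x = z • u x)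
    (hbc : C *ᵥ (u 0).ofLp + D *ᵥ (u 1).ofLp = 0) : u 0 = 0 := by
  have hcont := hu.hasACDeriv.continuousOn
  have hmem := memLp_of_continuousOn hcont
  -- An eigenpair: the resolvent sends `z u - z u = 0` back to `u`, so `u` vanishes in `L²`, and
  -- everywhere on `[0,1]` by continuity.
  have hgraph : (hmem.toLp u, z • hmem.toLp u) ∈ (bvpOperator b Q C D).graph := by
    rw [bvpOperator_graph]
    refine ⟨u, hmem.coeFn_toLp, hu, ?_, hbc⟩
    filter_upwards [hde, hmem.coeFn_toLp, Lp.coeFn_smul z (hmem.toLp u)] with x h1 h2 h3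
    rw [h3, Pi.smul_apply, h2, h1]
  obtain ⟨y, hy1, hy2⟩ := (LinearPMap.mem_graph_iff _).1 hgraph
  have hy := (resolventOf_spec hz).2 y
  rw [hy2, hy1, sub_self, map_zero] at hy
  replace hy : 0 = hmem.toLp u := hy
  have hae : u =ᵐ[unitMeasure] fun _ => 0 := by
    filter_upwards [hmem.coeFn_toLp, Lp.coeFn_zero (Cn n) 2 unitMeasure] with x h1 h2
    rw [← h1, ← hy, h2, Pi.zero_apply]
  exact Measure.eqOn_Icc_of_ae_eq volume zero_ne_one hae hcont continuousOn_const
    (left_mem_Icc.2 zero_le_one)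

/-- If `c` is in the kernel, the solution `u` with `u(0) = c` has `u(1) = Φ(1)c`, because `Ψu` is
constant. It therefore satisfies the boundary condition, and `c = u(0) = 0` off the spectrum. -/
theorem isUnit_boundary {b : Fin n → ℂ} (hb : ∀ j, b j ≠ 0)
    {Q Φ Ψ : ℝ → Matrix (Fin n) (Fin n) ℂ} (hQ : IsL1Potential Q)
    {C D : Matrix (Fin n) (Fin n) ℂ} {z : ℂ} (P : IsFundamentalPair (coeffMatrix b Q z) Φ Ψ)
    (hz : z ∈ resolventSetOf (bvpOperator b Q C D)) : IsUnit (C + D * Φ 1) := by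
  rw [← Matrix.mulVec_injective_iff_isUnit]
  refine (injective_iff_map_eq_zero (C + D * Φ 1).mulVecLin).2 fun c hc => ?_
  obtain ⟨u, hu, hu0⟩ := exists_hasACDeriv_mulVec (isL1Potential_coeffMatrix b hQ z)
    (WithLp.toLp 2 c)
  have hΨ0 : Ψ 0 = 1 := by simpa [P.zero] using P.inv 0 (by simp)
  have hΨu : Ψ 1 *ᵥ (u 1).ofLp = c := by
    ext l
    refine ((P.right.mulVec hu.hasVecDeriv l).eq_add_integral (x := 1) (by simp)).trans ?_
    simp [hu0, hΨ0, Matrix.neg_mulVec]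
  have hu1 : (u 1).ofLp = Φ 1 *ᵥ c := by
    rw [← hΨu, Matrix.mulVec_mulVec, P.mul_eq_one (by simp), Matrix.one_mulVec]
  have h0 : u 0 = 0 := by
    refine eq_zero_of_boundary hz hu.isW11 ?_ ?_
    · filter_upwards [hu.ae_deriv_eq] with x hx
      rw [← add_zero (z • u x), diffExpr_eq_iff hb, hx]
      ext j
      simp
    · rw [hu1, hu0, Matrix.mulVec_mulVec, ← Matrix.add_mulVec]
      exact hc
  rw [h0] at hu0
  simpa using hu0.symm

theorem exists_solution_of_resolvent {b : Fin n → ℂ} {Q : ℝ → Matrix (Fin n) (Fin n) ℂ}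
    {C D : Matrix (Fin n) (Fin n) ℂ} {z : ℂ} (hz : z ∈ resolventSetOf (bvpOperator b Q C D))
    (f : L2 n) :
    ∃ u : ℝ → Cn n, resolventOf (bvpOperator b Q C D) z f =ᵐ[unitMeasure] u ∧ IsW11 u ∧
      (∀ᵐ x ∂unitMeasure, diffExpr b Q u x = z • u x + f x) ∧
      C *ᵥ (u 0).ofLp + D *ᵥ (u 1).ofLp = 0 := by
  obtain ⟨hmem, heq⟩ := (resolventOf_spec hz).1 f
  have hg : (resolventOf (bvpOperator b Q C D) z f,
      bvpOperator b Q C D ⟨resolventOf (bvpOperator b Q C D) z f, hmem⟩) ∈ bvpGraph b Q C D := by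
    rw [← bvpOperator_graph]
    exact LinearPMap.mem_graph _ ⟨_, hmem⟩
  obtain ⟨u, h1, h2, h3, h4⟩ := hg
  refine ⟨u, h1, h2, ?_, h4⟩
  rw [sub_eq_iff_eq_add] at heq
  rw [heq] at h3
  filter_upwards [h1, h3, Lp.coeFn_add f (z • resolventOf (bvpOperator b Q C D) z f),
    Lp.coeFn_smul z (resolventOf (bvpOperator b Q C D) z f)] with x hx1 hx2 hx3 hx4
  rw [← hx2, hx3, Pi.add_apply, hx4, Pi.smul_apply, hx1, add_comm]

end BoundaryValueProblem

/-! ### Triangular kernels as integrals of rank one operators. -/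

section Kernels

variable {n : ℕ}

instance separableSpace_L2 : TopologicalSpace.SeparableSpace (L2 n) := by
  have : Fact ((2 : ENNReal) ≠ ⊤) := ⟨by simp⟩
  have : SecondCountableTopology (L2 n) := Lp.SecondCountableTopology
  infer_instance

/-- Fubini on the triangle `x ≤ s`. It makes the intermediate variable `s` the outer one, as the
rank one decomposition requires. -/
theorem integral_mul_integral_tail {G k : ℝ → ℂ} (hG : Integrable G unitMeasure)
    (hk : Integrable k unitMeasure) :
    ∫ x, G x * (∫ s in x..1, k s) ∂unitMeasure =
      ∫ s, k s * (∫ x, (Iic s).indicator G x ∂unitMeasure) ∂unitMeasure := by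
  have hswap := integral_integral_swap (μ := unitMeasure) (ν := unitMeasure)
    (f := fun x s => {p : ℝ × ℝ | p.1 ≤ p.2}.indicator (fun p => G p.1 * k p.2) (x, s))
    ((hG.mul_prod hk).indicator (measurableSet_le measurable_fst measurable_snd))
  have hleft : ∀ x ∈ Icc (0 : ℝ) 1, G x * (∫ s in x..1, k s) = ∫ s,
      {p : ℝ × ℝ | p.1 ≤ p.2}.indicator (fun p => G p.1 * k p.2) (x, s) ∂unitMeasure := by
    intro x hx
    have h1 : ∀ s, {p : ℝ × ℝ | p.1 ≤ p.2}.indicator (fun p => G p.1 * k p.2) (x, s) =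
        G x * (Ici x).indicator k s := fun s => by
      by_cases h : x ≤ s <;> simp [indicator, h]
    simp only [h1]
    rw [integral_const_mul, integral_indicator measurableSet_Ici,
      Measure.restrict_restrict measurableSet_Ici, intervalIntegral.integral_of_le hx.2,
      ← integral_Icc_eq_integral_Ioc]
    congr 4
    ext s
    simp only [mem_Icc, mem_inter_iff, mem_Ici]
    exact ⟨fun h => ⟨h.1, hx.1.trans h.1, h.2⟩, fun h => ⟨h.1, h.2.2⟩⟩
  have hright : ∀ s, k s * (∫ x, (Iic s).indicator G x ∂unitMeasure) = ∫ x,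
      {p : ℝ × ℝ | p.1 ≤ p.2}.indicator (fun p => G p.1 * k p.2) (x, s) ∂unitMeasure := by
    intro s
    rw [← integral_const_mul]
    congr 1
    ext x
    by_cases h : x ≤ s <;> simp [indicator, h, mul_comm]
  rw [integral_congr_ae (g := fun x => ∫ s, {p : ℝ × ℝ | p.1 ≤ p.2}.indicator
    (fun p => G p.1 * k p.2) (x, s) ∂unitMeasure), hswap]
  · simp only [hright]
  · filter_upwards [ae_restrict_mem measurableSet_Icc] with x hx using hleft x hx

/-- The restriction `1_S y` of `y`, as an element of `L²`. -/
noncomputable def cutoff {y : ℝ → Cn n} (hy : MemLp y 2 unitMeasure) {S : Set ℝ}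
    (hS : MeasurableSet S) : L2 n :=
  (hy.indicator hS).toLp (S.indicator y)

theorem norm_cutoff_le {y : ℝ → Cn n} (hy : MemLp y 2 unitMeasure) {S : Set ℝ}
    (hS : MeasurableSet S) : ‖cutoff hy hS‖ ≤ ‖hy.toLp y‖ := by
  rw [cutoff, Lp.norm_toLp, Lp.norm_toLp]
  exact ENNReal.toReal_mono hy.eLpNorm_ne_top (eLpNorm_indicator_le _)

theorem inner_cutoff_right {y : ℝ → Cn n} (hy : MemLp y 2 unitMeasure) {S : Set ℝ}
    (hS : MeasurableSet S) (g : L2 n) :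
    ⟪g, cutoff hy hS⟫_ℂ = ∫ x, S.indicator (fun x => ⟪g x, y x⟫_ℂ) x ∂unitMeasure := by
  rw [L2.inner_def]
  refine integral_congr_ae ?_
  filter_upwards [(hy.indicator hS).coeFn_toLp] with x hx
  rw [cutoff, hx]
  by_cases h : x ∈ S <;> simp [h]

theorem inner_cutoff_left {y : ℝ → Cn n} (hy : MemLp y 2 unitMeasure) {S : Set ℝ}
    (hS : MeasurableSet S) (f : L2 n) :
    ⟪cutoff hy hS, f⟫_ℂ = ∫ x, S.indicator (fun x => ⟪y x, f x⟫_ℂ) x ∂unitMeasure := by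
  rw [L2.inner_def]
  refine integral_congr_ae ?_
  filter_upwards [(hy.indicator hS).coeFn_toLp] with x hx
  rw [cutoff, hx]
  by_cases h : x ∈ S <;> simp [h]

theorem inner_cutoff_cutoff_eq_zero {y y' : ℝ → Cn n} (hy : MemLp y 2 unitMeasure)
    (hy' : MemLp y' 2 unitMeasure) {S S' : Set ℝ} (hS : MeasurableSet S) (hS' : MeasurableSet S')
    (hd : Disjoint S S') : ⟪cutoff hy hS, cutoff hy' hS'⟫_ℂ = 0 := by
  rw [inner_cutoff_left]
  refine integral_eq_zero_of_ae ?_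
  filter_upwards [(hy'.indicator hS').coeFn_toLp] with x hx
  by_cases h : x ∈ S
  · have h' : x ∉ S' := disjoint_left.1 hd h
    rw [indicator_of_mem h, cutoff, hx, indicator_of_notMem h', inner_zero_right, Pi.zero_apply]
  · rw [indicator_of_notMem h, Pi.zero_apply]

theorem aestronglyMeasurable_integral_indicator_Iic {G : ℝ → ℂ}
    (hG : AEStronglyMeasurable G unitMeasure) :
    AEStronglyMeasurable (fun s => ∫ x, (Iic s).indicator G x ∂unitMeasure) unitMeasure := by
  have := ((hG.comp_snd (μ := unitMeasure)).indicator
    (measurableSet_le measurable_snd measurable_fst)).integral_prod_right'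
  simpa [indicator] using this

theorem aestronglyMeasurable_integral_indicator_Ioi {G : ℝ → ℂ}
    (hG : AEStronglyMeasurable G unitMeasure) :
    AEStronglyMeasurable (fun s => ∫ x, (Ioi s).indicator G x ∂unitMeasure) unitMeasure := by
  have := ((hG.comp_snd (μ := unitMeasure)).indicator
    (measurableSet_lt measurable_fst measurable_snd)).integral_prod_right'
  simpa [indicator] using this

/-- An integral of the rank one operators `1_{x ≤ s} φ ⊗ 1_{t > s} ψ` has vanishing trace. -/
theorem isNuclearForm_cutoff {φ ψ : ℝ → Cn n} (hφ : MemLp φ 2 unitMeasure)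
    (hψ : MemLp ψ 2 unitMeasure) {w : ℝ → ℂ} (hw : Integrable w unitMeasure) :
    IsNuclearForm (fun g f : L2 n => ∫ s, w s * (⟪g, cutoff hφ (measurableSet_Iic (a := s))⟫_ℂ *
      ⟪cutoff hψ (measurableSet_Ioi (a := s)), f⟫_ℂ) ∂unitMeasure) 0 := by
  have key := isNuclearForm_integral (μ := unitMeasure) (w := w)
    (α := fun s => cutoff hφ (measurableSet_Iic (a := s)))
    (κ := fun s => cutoff hψ (measurableSet_Ioi (a := s)))
    (ρ := fun s => ‖w s‖ * (‖hφ.toLp φ‖ * ‖hψ.toLp ψ‖)) hw.aestronglyMeasurable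
    (fun g => ?_) (fun f => ?_) (hw.norm.mul_const _) (.of_forall fun s => ?_)
  -- The closed ray `x ≤ s` and the open ray `t > s` are disjoint, so the trace integrand is zero
  -- for every `s`.
  · have h0 : ∀ s, ⟪cutoff hψ (measurableSet_Ioi (a := s)),
        cutoff hφ (measurableSet_Iic (a := s))⟫_ℂ = 0 := fun s =>
      inner_cutoff_cutoff_eq_zero _ _ _ _ (Iic_disjoint_Ioi le_rfl).symm
    simpa only [h0, mul_zero, integral_zero] using key
  · simp only [inner_cutoff_right]
    exact aestronglyMeasurable_integral_indicator_Iic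
      ((Lp.aestronglyMeasurable g).inner hφ.aestronglyMeasurable)
  · simp only [inner_cutoff_left]
    exact aestronglyMeasurable_integral_indicator_Ioi
      (hψ.aestronglyMeasurable.inner (Lp.aestronglyMeasurable f))
  · gcongr <;> exact norm_cutoff_le _ _

end Kernels

/-! ### The resolvent difference as a nuclear form, and its trace. -/

section TraceFormula

variable {n : ℕ}

/-- The right-hand side `i B f` of the first order system. -/
noncomputable def source (b : Fin n → ℂ) (f : ℝ → Cn n) (x : ℝ) : Fin n → ℂ :=
  fun j => Complex.I * b j * f x j

/-- The conjugated rows of `Ψ i B`. -/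
noncomputable def dualRow (b : Fin n → ℂ) (Ψ : ℝ → Matrix (Fin n) (Fin n) ℂ) (l : Fin n) (x : ℝ) :
    Cn n :=
  WithLp.toLp 2 fun k => star (Ψ x l k * (Complex.I * b k))

/-- The columns of `Φ`. -/
noncomputable def column (Φ : ℝ → Matrix (Fin n) (Fin n) ℂ) (m : Fin n) (x : ℝ) : Cn n :=
  WithLp.toLp 2 ((Φ x).col m)

/-- The conjugation in `dualRow` undoes the conjugate linearity of the inner product in its first
slot. -/
theorem inner_dualRow (b : Fin n → ℂ) (Ψ : ℝ → Matrix (Fin n) (Fin n) ℂ) (l : Fin n) (f : ℝ → Cn n)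
    (x : ℝ) : ⟪dualRow b Ψ l x, f x⟫_ℂ = (Ψ x *ᵥ source b f x) l := by
  simp only [dualRow, source, PiLp.inner_apply, RCLike.inner_apply, Matrix.mulVec, dotProduct]
  refine Finset.sum_congr rfl fun k _ => ?_
  simp only [← starRingEnd_apply, RingHomCompTriple.comp_apply, RingHom.id_apply]
  ring

theorem inner_mulVec (Φ : ℝ → Matrix (Fin n) (Fin n) ℂ) (v : Fin n → ℂ) (x : ℝ) (y : Cn n) :
    ⟪y, WithLp.toLp 2 (Φ x *ᵥ v)⟫_ℂ = ∑ m, ⟪y, column Φ m x⟫_ℂ * v m := by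
  simp only [column, PiLp.inner_apply, RCLike.inner_apply, Matrix.mulVec, dotProduct,
    Finset.sum_mul]
  rw [Finset.sum_comm]
  refine Finset.sum_congr rfl fun k _ => Finset.sum_congr rfl fun m _ => ?_
  simp only [Matrix.col_apply]
  ring

theorem memLp_column {Φ : ℝ → Matrix (Fin n) (Fin n) ℂ} (hΦ : ContinuousOn Φ (Icc 0 1))
    (m : Fin n) : MemLp (column Φ m) 2 unitMeasure := by
  refine memLp_of_continuousOn ((PiLp.continuous_toLp 2 _).comp_continuousOn ?_)
  exact continuousOn_pi.2 fun j => continuousOn_pi.1 (continuousOn_pi.1 hΦ j) m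

theorem memLp_dualRow (b : Fin n → ℂ) {Ψ : ℝ → Matrix (Fin n) (Fin n) ℂ}
    (hΨ : ContinuousOn Ψ (Icc 0 1)) (l : Fin n) : MemLp (dualRow b Ψ l) 2 unitMeasure := by
  refine memLp_of_continuousOn ((PiLp.continuous_toLp 2 _).comp_continuousOn ?_)
  exact continuousOn_pi.2 fun k =>
    ((continuousOn_pi.1 (continuousOn_pi.1 hΨ l) k).mul continuousOn_const).star

theorem inner_toLp_right {y : ℝ → Cn n} (hy : MemLp y 2 unitMeasure) (g : L2 n) :
    ⟪g, hy.toLp y⟫_ℂ = ∫ x, ⟪g x, y x⟫_ℂ ∂unitMeasure := by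
  rw [L2.inner_def]
  refine integral_congr_ae ?_
  filter_upwards [hy.coeFn_toLp] with x hx
  rw [hx]

theorem inner_toLp_left {y : ℝ → Cn n} (hy : MemLp y 2 unitMeasure) (f : L2 n) :
    ⟪hy.toLp y, f⟫_ℂ = ∫ x, ⟪y x, f x⟫_ℂ ∂unitMeasure := by
  rw [L2.inner_def]
  refine integral_congr_ae ?_
  filter_upwards [hy.coeFn_toLp] with x hx
  rw [hx]

theorem integrable_inner_memLp (g : L2 n) {y : ℝ → Cn n} (hy : MemLp y 2 unitMeasure) :
    Integrable (fun x => ⟪g x, y x⟫_ℂ) unitMeasure := by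
  refine (L2.integrable_inner g (hy.toLp y)).congr ?_
  filter_upwards [hy.coeFn_toLp] with x hx
  rw [hx]

theorem integral_unitMeasure_eq (G : ℝ → ℂ) : ∫ x, G x ∂unitMeasure = ∫ x in (0 : ℝ)..1, G x := by
  rw [intervalIntegral.integral_of_le zero_le_one, integral_Icc_eq_integral_Ioc]

theorem integrableOn_source (b : Fin n → ℂ) (f : L2 n) (j : Fin n) :
    IntegrableOn (fun x => source b f x j) (Icc (0 : ℝ) 1) :=
  ((EuclideanSpace.proj j : Cn n →L[ℂ] ℂ).integrable_comp
    ((Lp.memLp f).integrable one_le_two)).const_mul _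

theorem tailIntegral_zero_eq_inner (b : Fin n → ℂ) {Ψ : ℝ → Matrix (Fin n) (Fin n) ℂ}
    (hΨ : ContinuousOn Ψ (Icc 0 1)) (f : L2 n) (l : Fin n) :
    tailIntegral Ψ (source b f) 0 l =
      ⟪(memLp_dualRow b hΨ l).toLp (dualRow b Ψ l), f⟫_ℂ := by
  simp only [inner_toLp_left, inner_dualRow, integral_unitMeasure_eq, tailIntegral]

theorem tailIntegral_eq_inner (b : Fin n → ℂ) {Ψ : ℝ → Matrix (Fin n) (Fin n) ℂ}
    (hΨ : ContinuousOn Ψ (Icc 0 1)) (f : L2 n) (l : Fin n) {s : ℝ} (hs : s ∈ Icc (0 : ℝ) 1) :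
    tailIntegral Ψ (source b f) s l =
      ⟪cutoff (memLp_dualRow b hΨ l) (measurableSet_Ioi (a := s)), f⟫_ℂ := by
  rw [inner_cutoff_left, integral_indicator measurableSet_Ioi,
    Measure.restrict_restrict measurableSet_Ioi, tailIntegral,
    intervalIntegral.integral_of_le hs.2]
  simp only [inner_dualRow]
  congr 2
  ext t
  simp only [mem_Ioc, mem_inter_iff, mem_Ioi, mem_Icc]
  exact ⟨fun h => ⟨h.1, hs.1.trans h.1.le, h.2⟩, fun h => ⟨h.1, h.2.2⟩⟩

/-- The form of the operator with kernel `Φ(x) N Ψ(t) i B`. -/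
noncomputable def finiteRankForm (b : Fin n → ℂ) (N : Matrix (Fin n) (Fin n) ℂ)
    {Φ Ψ : ℝ → Matrix (Fin n) (Fin n) ℂ} (hΦ : ContinuousOn Φ (Icc 0 1))
    (hΨ : ContinuousOn Ψ (Icc 0 1)) (g f : L2 n) : ℂ :=
  ∑ m, ∑ l, N m l * (⟪g, (memLp_column hΦ m).toLp (column Φ m)⟫_ℂ *
    ⟪(memLp_dualRow b hΨ l).toLp (dualRow b Ψ l), f⟫_ℂ)

theorem integral_inner_mulVec_eq_finiteRankForm (b : Fin n → ℂ) (N : Matrix (Fin n) (Fin n) ℂ)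
    {Φ Ψ : ℝ → Matrix (Fin n) (Fin n) ℂ} (hΦ : ContinuousOn Φ (Icc 0 1))
    (hΨ : ContinuousOn Ψ (Icc 0 1)) (g f : L2 n) :
    ∫ x, ⟪g x, WithLp.toLp 2 (Φ x *ᵥ (N *ᵥ tailIntegral Ψ (source b f) 0))⟫_ℂ ∂unitMeasure =
      finiteRankForm b N hΦ hΨ g f := by
  simp only [inner_mulVec]
  rw [integral_finsetSum _ fun m _ => (integrable_inner_memLp g (memLp_column hΦ m)).mul_const _]
  refine Finset.sum_congr rfl fun m _ => ?_
  rw [integral_mul_const, ← inner_toLp_right (memLp_column hΦ m), Matrix.mulVec, dotProduct,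
    Finset.mul_sum]
  refine Finset.sum_congr rfl fun l _ => ?_
  rw [tailIntegral_zero_eq_inner b hΨ]
  ring

/-- The diagonal `Φ(x) N Ψ(x) i B` of the kernel of `finiteRankForm`. -/
noncomputable def kernelDiagonal (b : Fin n → ℂ) (N : Matrix (Fin n) (Fin n) ℂ)
    (Φ Ψ : ℝ → Matrix (Fin n) (Fin n) ℂ) (x : ℝ) : Matrix (Fin n) (Fin n) ℂ :=
  Φ x * N * Ψ x * (Complex.I • Matrix.diagonal b)

theorem continuousOn_kernelDiagonal (b : Fin n → ℂ) (N : Matrix (Fin n) (Fin n) ℂ)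
    {Φ Ψ : ℝ → Matrix (Fin n) (Fin n) ℂ} (hΦ : ContinuousOn Φ (Icc 0 1))
    (hΨ : ContinuousOn Ψ (Icc 0 1)) (j k : Fin n) :
    ContinuousOn (fun x => kernelDiagonal b N Φ Ψ x j k) (Icc 0 1) :=
  continuousOn_pi.1 (continuousOn_pi.1
    (((hΦ.mul continuousOn_const).mul hΨ).mul continuousOn_const) j) k

/-- The inner products are the entries of `Ψ(x) iB Φ(x)`; cyclicity of the trace moves `Φ(x)` to the
front. -/
theorem trace_kernelDiagonal (b : Fin n → ℂ) (N : Matrix (Fin n) (Fin n) ℂ)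
    (Φ Ψ : ℝ → Matrix (Fin n) (Fin n) ℂ) (x : ℝ) :
    ∑ m, ∑ l, N m l * ⟪dualRow b Ψ l x, column Φ m x⟫_ℂ = (kernelDiagonal b N Φ Ψ x).trace := by
  have h : ∀ l m, ⟪dualRow b Ψ l x, column Φ m x⟫_ℂ =
      (Ψ x * (Complex.I • Matrix.diagonal b) * Φ x) l m := by
    intro l m
    rw [inner_dualRow b Ψ l (column Φ m)]
    simp only [Matrix.mulVec, dotProduct, source, column, Matrix.mul_apply, Matrix.col_apply]
    refine Finset.sum_congr rfl fun k _ => ?_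
    rw [← Matrix.mul_apply, Matrix.mul_smul, Matrix.smul_apply, Matrix.mul_diagonal, smul_eq_mul]
    ring
  have h2 : kernelDiagonal b N Φ Ψ x =
      Φ x * (N * (Ψ x * (Complex.I • Matrix.diagonal b))) := by
    simp only [kernelDiagonal, Matrix.mul_assoc]
  rw [h2, Matrix.trace_mul_comm, Matrix.mul_assoc]
  simp only [h, Matrix.trace, Matrix.diag_apply]
  exact Finset.sum_congr rfl fun m _ => (Matrix.mul_apply ..).symm

/-- The rank one pieces have traces `N m l * ⟪ψ_l, φ_m⟫`; written as integrals over `x`, they add up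
to the trace of the kernel on the diagonal. -/
theorem isNuclearForm_finiteRankForm (b : Fin n → ℂ) (N : Matrix (Fin n) (Fin n) ℂ)
    {Φ Ψ : ℝ → Matrix (Fin n) (Fin n) ℂ} (hΦ : ContinuousOn Φ (Icc 0 1))
    (hΨ : ContinuousOn Ψ (Icc 0 1)) :
    IsNuclearForm (finiteRankForm b N hΦ hΨ)
      (∫ x in (0 : ℝ)..1, (kernelDiagonal b N Φ Ψ x).trace) := by
  have key := IsNuclearForm.sum Finset.univ fun m _ => IsNuclearForm.sum Finset.univ fun l _ =>
    isNuclearForm_rankOne (N m l) ((memLp_column hΦ m).toLp (column Φ m))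
      ((memLp_dualRow b hΨ l).toLp (dualRow b Ψ l))
  have hint : ∀ l m, Integrable (fun x => ⟪dualRow b Ψ l x, column Φ m x⟫_ℂ) unitMeasure := by
    intro l m
    refine (integrable_inner_memLp ((memLp_dualRow b hΨ l).toLp _) (memLp_column hΦ m)).congr ?_
    filter_upwards [(memLp_dualRow b hΨ l).coeFn_toLp] with x hx
    rw [hx]
  have hval : ∀ l m, ⟪(memLp_dualRow b hΨ l).toLp (dualRow b Ψ l),
      (memLp_column hΦ m).toLp (column Φ m)⟫_ℂ =
        ∫ x, ⟪dualRow b Ψ l x, column Φ m x⟫_ℂ ∂unitMeasure := by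
    intro l m
    rw [inner_toLp_left]
    refine integral_congr_ae ?_
    filter_upwards [(memLp_column hΦ m).coeFn_toLp] with x hx
    rw [hx]
  convert key using 1
  · rfl
  rw [← integral_unitMeasure_eq]
  simp only [← trace_kernelDiagonal, hval]
  refine (integral_finsetSum Finset.univ fun m _ => integrable_finsetSum Finset.univ fun l _ =>
    (hint l m).const_mul (N m l)).trans (Finset.sum_congr rfl fun m _ => ?_)
  refine (integral_finsetSum Finset.univ fun l _ => (hint l m).const_mul (N m l)).trans ?_
  exact Finset.sum_congr rfl fun l _ => integral_const_mul _ _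

/-- The form of the operator with kernel `∫ 1_{x ≤ s < t} Φ(x) w(s) Ψ(t) i B ds`. -/
noncomputable def volterraForm (b : Fin n → ℂ) (w : ℝ → Matrix (Fin n) (Fin n) ℂ)
    {Φ Ψ : ℝ → Matrix (Fin n) (Fin n) ℂ} (hΦ : ContinuousOn Φ (Icc 0 1))
    (hΨ : ContinuousOn Ψ (Icc 0 1)) (g f : L2 n) : ℂ :=
  ∑ m, ∑ l, ∫ s, w s m l * (⟪g, cutoff (memLp_column hΦ m) (measurableSet_Iic (a := s))⟫_ℂ *
    ⟪cutoff (memLp_dualRow b hΨ l) (measurableSet_Ioi (a := s)), f⟫_ℂ) ∂unitMeasure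

theorem isNuclearForm_volterraForm (b : Fin n → ℂ) {w : ℝ → Matrix (Fin n) (Fin n) ℂ}
    (hw : IsL1Potential w) {Φ Ψ : ℝ → Matrix (Fin n) (Fin n) ℂ} (hΦ : ContinuousOn Φ (Icc 0 1))
    (hΨ : ContinuousOn Ψ (Icc 0 1)) : IsNuclearForm (volterraForm b w hΦ hΨ) 0 := by
  have key := IsNuclearForm.sum Finset.univ fun m _ => IsNuclearForm.sum Finset.univ fun l _ =>
    isNuclearForm_cutoff (memLp_column hΦ m) (memLp_dualRow b hΨ l) (hw m l)
  simpa using! key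

theorem integrable_inner_mul_continuousOn (g : L2 n) {y : ℝ → Cn n} (hy : MemLp y 2 unitMeasure)
    {k : ℝ → ℂ} (hk : IntegrableOn k (Icc (0 : ℝ) 1)) :
    Integrable (fun x => ⟪g x, y x⟫_ℂ * ∫ s in x..1, k s) unitMeasure := by
  have hc := intervalIntegral.continuousOn_primitive_interval_left (f := k) (a := 0) (b := 1)
    (μ := volume) (by rwa [uIcc_of_le zero_le_one])
  rw [uIcc_of_le zero_le_one] at hc
  exact IntegrableOn.mul_continuousOn (integrable_inner_memLp g hy) hc isCompact_Icc

/-- After expansion in coordinates and Fubini, the tail beyond `s` is the pairing of `f` with a row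
cut off to `t > s`, and the integral over `x ≤ s` is the pairing of `g` with a cut off column. -/
theorem integral_inner_mulVec_eq_volterraForm (b : Fin n → ℂ)
    {w : ℝ → Matrix (Fin n) (Fin n) ℂ}
    (hw : IsL1Potential w) {Φ Ψ : ℝ → Matrix (Fin n) (Fin n) ℂ} (hΦ : ContinuousOn Φ (Icc 0 1))
    (hΨ : ContinuousOn Ψ (Icc 0 1)) (g f : L2 n) :
    ∫ x, ⟪g x, WithLp.toLp 2 (Φ x *ᵥ tailIntegral w (tailIntegral Ψ (source b f)) x)⟫_ℂ
      ∂unitMeasure = volterraForm b w hΦ hΨ g f := by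
  have hτ : ∀ l, ContinuousOn (fun s => tailIntegral Ψ (source b f) s l) (Icc 0 1) := fun l =>
    (hasVecDeriv_tailIntegral hΨ (integrableOn_source b f) l).continuousOn
  have hk : ∀ m l, IntegrableOn (fun s => w s m l * tailIntegral Ψ (source b f) s l)
      (Icc (0 : ℝ) 1) := fun m l => (hw m l).mul_continuousOn (hτ l) isCompact_Icc
  have hint := fun m l => integrable_inner_mul_continuousOn g (memLp_column hΦ m) (hk m l)
  have hexpand : ∀ x ∈ Icc (0 : ℝ) 1,
      ⟪g x, WithLp.toLp 2 (Φ x *ᵥ tailIntegral w (tailIntegral Ψ (source b f)) x)⟫_ℂ =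
        ∑ m, ∑ l, ⟪g x, column Φ m x⟫_ℂ *
          ∫ s in x..1, w s m l * tailIntegral Ψ (source b f) s l := by
    intro x hx
    rw [inner_mulVec]
    refine Finset.sum_congr rfl fun m _ => ?_
    rw [← Finset.mul_sum, ← intervalIntegral.integral_finsetSum fun l _ =>
      (HasACDeriv.integral (hk m l)).intervalIntegrable hx (by simp)]
    rfl
  rw [integral_congr_ae (g := fun x => ∑ m, ∑ l, ⟪g x, column Φ m x⟫_ℂ *
          ∫ s in x..1, w s m l * tailIntegral Ψ (source b f) s l),
    integral_finsetSum _ fun m _ => integrable_finsetSum _ fun l _ => hint m l]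
  · refine Finset.sum_congr rfl fun m _ => ?_
    rw [integral_finsetSum _ fun l _ => hint m l]
    refine Finset.sum_congr rfl fun l _ => ?_
    rw [integral_mul_integral_tail (integrable_inner_memLp g (memLp_column hΦ m)) (hk m l)]
    refine integral_congr_ae ?_
    filter_upwards [ae_restrict_mem measurableSet_Icc] with s hs
    rw [← tailIntegral_eq_inner b hΨ f l hs, inner_cutoff_right]
    ring
  · filter_upwards [ae_restrict_mem measurableSet_Icc] with x hx using hexpand x hx

theorem resolventOf_ae_eq {b : Fin n → ℂ} (hb : ∀ j, b j ≠ 0)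
    {Q Φ Ψ : ℝ → Matrix (Fin n) (Fin n) ℂ} {C D : Matrix (Fin n) (Fin n) ℂ} {z : ℂ}
    (P : IsFundamentalPair (coeffMatrix b Q z) Φ Ψ) (hU : IsUnit (C + D * Φ 1))
    (hz : z ∈ resolventSetOf (bvpOperator b Q C D)) (f : L2 n) :
    resolventOf (bvpOperator b Q C D) z f =ᵐ[unitMeasure] fun x => WithLp.toLp 2
      (Φ x *ᵥ (((C + D * Φ 1)⁻¹ * C) *ᵥ tailIntegral Ψ (source b f) 0) -
        Φ x *ᵥ tailIntegral Ψ (source b f) x) := by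
  obtain ⟨u, h1, h2, h3, h4⟩ := exists_solution_of_resolvent hz f
  have hinv : (C + D * Φ 1)⁻¹ * (C + D * Φ 1) = 1 :=
    Matrix.nonsing_inv_mul _ ((Matrix.isUnit_iff_isUnit_det _).1 hU)
  filter_upwards [h1, ae_restrict_mem measurableSet_Icc] with x hx1 hx
  rw [hx1, ← Matrix.mulVec_sub]
  exact congrArg (WithLp.toLp 2) (P.eq_of_boundary hinv (h2.hasVecDeriv_of_diffExpr hb h3) h4 hx)

variable {b : Fin n → ℂ} {Q₁ Q₂ Φ₁ Φ₂ Ψ₁ Ψ₂ : ℝ → Matrix (Fin n) (Fin n) ℂ}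
  {C₁ D₁ C₂ D₂ : Matrix (Fin n) (Fin n) ℂ} {z : ℂ}

/-- The coupling `Ψ₁ (A₂ - A₁) Φ₂` of two systems, the derivative of `Ψ₁ Φ₂`. -/
noncomputable def coupling (b : Fin n → ℂ) (z : ℂ)
    (Q₁ Q₂ Φ₂ Ψ₁ : ℝ → Matrix (Fin n) (Fin n) ℂ) (s : ℝ) : Matrix (Fin n) (Fin n) ℂ :=
  Ψ₁ s * (coeffMatrix b Q₂ z s - coeffMatrix b Q₁ z s) * Φ₂ s

/-- Integrability comes for free, because the coupling is the derivative of `Ψ₁Φ₂` given by the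
product rule. -/
theorem isL1Potential_coupling (P₁ : IsFundamentalPair (coeffMatrix b Q₁ z) Φ₁ Ψ₁)
    (P₂ : IsFundamentalPair (coeffMatrix b Q₂ z) Φ₂ Ψ₂) :
    IsL1Potential (coupling b z Q₁ Q₂ Φ₂ Ψ₁) := by
  intro i j
  refine ((P₁.right.mul P₂.left) i j).integrable.congr (.of_forall fun s => ?_)
  refine congrFun (congrFun ?_ i) j
  simp only [coupling]
  noncomm_ring

/-- The Volterra form pairs columns of `Φ₁` with rows of `Ψ₂`: the difference of the two tails
factors through both systems. -/
theorem inner_resolventOf_sub (hb : ∀ j, b j ≠ 0)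
    (P₁ : IsFundamentalPair (coeffMatrix b Q₁ z) Φ₁ Ψ₁)
    (P₂ : IsFundamentalPair (coeffMatrix b Q₂ z) Φ₂ Ψ₂)
    (hU₁ : IsUnit (C₁ + D₁ * Φ₁ 1)) (hU₂ : IsUnit (C₂ + D₂ * Φ₂ 1))
    (hz₁ : z ∈ resolventSetOf (bvpOperator b Q₁ C₁ D₁))
    (hz₂ : z ∈ resolventSetOf (bvpOperator b Q₂ C₂ D₂)) (g f : L2 n) :
    ⟪g, (resolventOf (bvpOperator b Q₁ C₁ D₁) z - resolventOf (bvpOperator b Q₂ C₂ D₂) z) f⟫_ℂ =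
      finiteRankForm b ((C₁ + D₁ * Φ₁ 1)⁻¹ * C₁) P₁.left.continuousOn P₁.right.continuousOn g f -
      finiteRankForm b ((C₂ + D₂ * Φ₂ 1)⁻¹ * C₂) P₂.left.continuousOn P₂.right.continuousOn g f -
      volterraForm b (coupling b z Q₁ Q₂ Φ₂ Ψ₁) P₁.left.continuousOn P₂.right.continuousOn g f := by
  have hw := isL1Potential_coupling P₁ P₂
  rw [← integral_inner_mulVec_eq_finiteRankForm, ← integral_inner_mulVec_eq_finiteRankForm,
    ← integral_inner_mulVec_eq_volterraForm b hw, L2.inner_def]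
  have hfin : ∀ {Φ : ℝ → Matrix (Fin n) (Fin n) ℂ}, ContinuousOn Φ (Icc 0 1) → ∀ v : Fin n → ℂ,
      Integrable (fun x => ⟪g x, WithLp.toLp 2 (Φ x *ᵥ v)⟫_ℂ) unitMeasure := by
    intro Φ hΦ v
    simp only [inner_mulVec]
    exact integrable_finsetSum _ fun m _ =>
      (integrable_inner_memLp g (memLp_column hΦ m)).mul_const _
  have hvol : Integrable (fun x => ⟪g x, WithLp.toLp 2 (Φ₁ x *ᵥ tailIntegral
      (coupling b z Q₁ Q₂ Φ₂ Ψ₁) (tailIntegral Ψ₂ (source b f)) x)⟫_ℂ) unitMeasure := by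
    simp only [inner_mulVec]
    exact integrable_finsetSum _ fun m _ => integrable_inner_mul_continuousOn g
      (memLp_column P₁.left.continuousOn m) (integrableOn_mulVec_of_isL1Potential hw (fun l =>
        (hasVecDeriv_tailIntegral P₂.right.continuousOn
          (integrableOn_source b f) l).continuousOn) m)
  rw [← integral_sub (hfin P₁.left.continuousOn _) (hfin P₂.left.continuousOn _)]
  refine Eq.trans (integral_congr_ae ?_)
    (integral_sub ((hfin P₁.left.continuousOn _).sub (hfin P₂.left.continuousOn _)) hvol)
  filter_upwards [resolventOf_ae_eq hb P₁ hU₁ hz₁ f, resolventOf_ae_eq hb P₂ hU₂ hz₂ f,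
    Lp.coeFn_sub (resolventOf (bvpOperator b Q₁ C₁ D₁) z f)
      (resolventOf (bvpOperator b Q₂ C₂ D₂) z f),
    ae_restrict_mem measurableSet_Icc] with x h1 h2 h3 hx
  have hdiff := mulVec_tailIntegral_sub P₁ P₂ (integrableOn_source b f) hx
  rw [sub_apply, h3, Pi.sub_apply, h1, h2, ← inner_sub_right,
    ← inner_sub_right]
  congr 1
  rw [← WithLp.toLp_sub, ← WithLp.toLp_sub, ← WithLp.toLp_sub]
  congr 1
  change _ = _ - Φ₁ x *ᵥ tailIntegral (fun s => Ψ₁ s *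
    (coeffMatrix b Q₂ z s - coeffMatrix b Q₁ z s) * Φ₂ s) (tailIntegral Ψ₂ (source b f)) x
  rw [← hdiff]
  exact sub_sub_sub_comm _ _ _ _

theorem traceIntegrand_eq (P₁ : IsFundamentalPair (coeffMatrix b Q₁ z) Φ₁ Ψ₁)
    (P₂ : IsFundamentalPair (coeffMatrix b Q₂ z) Φ₂ Ψ₂) {x : ℝ} (hx : x ∈ Icc (0 : ℝ) 1) :
    traceIntegrand b C₁ D₁ C₂ D₂ Φ₁ Φ₂ x =
      kernelDiagonal b ((C₁ + D₁ * Φ₁ 1)⁻¹ * C₁) Φ₁ Ψ₁ x -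
        kernelDiagonal b ((C₂ + D₂ * Φ₂ 1)⁻¹ * C₂) Φ₂ Ψ₂ x := by
  simp only [traceIntegrand, kernelDiagonal, P₁.inv_eq hx, P₂.inv_eq hx, Matrix.sub_mul,
    Matrix.mul_assoc]

theorem intervalIntegrable_kernelDiagonal (P : IsFundamentalPair (coeffMatrix b Q₁ z) Φ₁ Ψ₁)
    (N : Matrix (Fin n) (Fin n) ℂ) (j k : Fin n) :
    IntervalIntegrable (fun x => kernelDiagonal b N Φ₁ Ψ₁ x j k) volume 0 1 := by
  refine ContinuousOn.intervalIntegrable ?_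
  rw [uIcc_of_le zero_le_one]
  exact continuousOn_kernelDiagonal b N P.left.continuousOn P.right.continuousOn j k

theorem trace_matrixIntegral_traceIntegrand
    (P₁ : IsFundamentalPair (coeffMatrix b Q₁ z) Φ₁ Ψ₁)
    (P₂ : IsFundamentalPair (coeffMatrix b Q₂ z) Φ₂ Ψ₂) :
    (matrixIntegral (traceIntegrand b C₁ D₁ C₂ D₂ Φ₁ Φ₂)).trace =
      (∫ x in (0 : ℝ)..1, (kernelDiagonal b ((C₁ + D₁ * Φ₁ 1)⁻¹ * C₁) Φ₁ Ψ₁ x).trace) -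
        ∫ x in (0 : ℝ)..1, (kernelDiagonal b ((C₂ + D₂ * Φ₂ 1)⁻¹ * C₂) Φ₂ Ψ₂ x).trace := by
  simp only [Matrix.trace, Matrix.diag_apply, matrixIntegral, Matrix.of_apply]
  rw [intervalIntegral.integral_finsetSum fun j _ => intervalIntegrable_kernelDiagonal P₁ _ j j,
    intervalIntegral.integral_finsetSum fun j _ => intervalIntegrable_kernelDiagonal P₂ _ j j,
    ← Finset.sum_sub_distrib]
  refine Finset.sum_congr rfl fun j _ => ?_
  rw [← intervalIntegral.integral_sub (intervalIntegrable_kernelDiagonal P₁ _ j j)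
    (intervalIntegrable_kernelDiagonal P₂ _ j j)]
  refine intervalIntegral.integral_congr fun x hx => ?_
  rw [uIcc_of_le zero_le_one] at hx
  exact congrFun (congrFun (traceIntegrand_eq P₁ P₂ hx) j) j

theorem intervalIntegrable_traceIntegrand
    (P₁ : IsFundamentalPair (coeffMatrix b Q₁ z) Φ₁ Ψ₁)
    (P₂ : IsFundamentalPair (coeffMatrix b Q₂ z) Φ₂ Ψ₂) (j k : Fin n) :
    IntervalIntegrable (fun x => traceIntegrand b C₁ D₁ C₂ D₂ Φ₁ Φ₂ x j k) volume 0 1 := by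
  refine ((intervalIntegrable_kernelDiagonal P₁ ((C₁ + D₁ * Φ₁ 1)⁻¹ * C₁) j k).sub
    (intervalIntegrable_kernelDiagonal P₂ ((C₂ + D₂ * Φ₂ 1)⁻¹ * C₂) j k)).congr fun x hx => ?_
  rw [uIoc_of_le zero_le_one] at hx
  exact congrFun (congrFun (traceIntegrand_eq P₁ P₂ (Ioc_subset_Icc_self hx)).symm j) k

theorem isTraceClass_and_hasTrace_resolventOf_sub (hb : ∀ j, b j ≠ 0)
    (P₁ : IsFundamentalPair (coeffMatrix b Q₁ z) Φ₁ Ψ₁)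
    (P₂ : IsFundamentalPair (coeffMatrix b Q₂ z) Φ₂ Ψ₂)
    (hU₁ : IsUnit (C₁ + D₁ * Φ₁ 1)) (hU₂ : IsUnit (C₂ + D₂ * Φ₂ 1))
    (hz₁ : z ∈ resolventSetOf (bvpOperator b Q₁ C₁ D₁))
    (hz₂ : z ∈ resolventSetOf (bvpOperator b Q₂ C₂ D₂)) :
    IsTraceClass (resolventOf (bvpOperator b Q₁ C₁ D₁) z -
        resolventOf (bvpOperator b Q₂ C₂ D₂) z) ∧
      HasTrace (resolventOf (bvpOperator b Q₁ C₁ D₁) z - resolventOf (bvpOperator b Q₂ C₂ D₂) z)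
        (matrixIntegral (traceIntegrand b C₁ D₁ C₂ D₂ Φ₁ Φ₂)).trace := by
  have hform := ((isNuclearForm_finiteRankForm b ((C₁ + D₁ * Φ₁ 1)⁻¹ * C₁) P₁.left.continuousOn
    P₁.right.continuousOn).sub (isNuclearForm_finiteRankForm b ((C₂ + D₂ * Φ₂ 1)⁻¹ * C₂)
      P₂.left.continuousOn P₂.right.continuousOn)).sub
    (isNuclearForm_volterraForm b (isL1Potential_coupling P₁ P₂) P₁.left.continuousOn
      P₂.right.continuousOn)
  rw [sub_zero, ← trace_matrixIntegral_traceIntegrand P₁ P₂] at hform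
  have hT := inner_resolventOf_sub hb P₁ P₂ hU₁ hU₂ hz₁ hz₂
  exact ⟨hform.isTraceClass hT, hform.hasTrace hT⟩

end TraceFormula

end DiracBVP

theorem mainTheorem5 (n : ℕ) (b : Fin n → ℂ) (hb : ∀ j, b j ≠ 0)
    (Q₁ Q₂ : ℝ → Matrix (Fin n) (Fin n) ℂ)
    (hQ₁ : DiracBVP.IsL1Potential Q₁) (hQ₂ : DiracBVP.IsL1Potential Q₂)
    (C₁ D₁ C₂ D₂ : Matrix (Fin n) (Fin n) ℂ)
    (hrank₁ : (Matrix.fromCols C₁ D₁).rank = n) (hrank₂ : (Matrix.fromCols C₂ D₂).rank = n)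
    (z : ℂ)
    (hz₁ : z ∈ DiracBVP.resolventSetOf (DiracBVP.bvpOperator b Q₁ C₁ D₁))
    (hz₂ : z ∈ DiracBVP.resolventSetOf (DiracBVP.bvpOperator b Q₂ C₂ D₂)) :
    DiracBVP.IsTraceClass
        (DiracBVP.resolventOf (DiracBVP.bvpOperator b Q₁ C₁ D₁) z -
          DiracBVP.resolventOf (DiracBVP.bvpOperator b Q₂ C₂ D₂) z) ∧
      (∃ Φ₁, DiracBVP.IsFundamentalMatrix b Q₁ z Φ₁) ∧
      (∃ Φ₂, DiracBVP.IsFundamentalMatrix b Q₂ z Φ₂) ∧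
      ∀ Φ₁ Φ₂ : ℝ → Matrix (Fin n) (Fin n) ℂ,
        DiracBVP.IsFundamentalMatrix b Q₁ z Φ₁ → DiracBVP.IsFundamentalMatrix b Q₂ z Φ₂ →
        -- all inverses and integrals in the trace formula are genuine
        (∀ x ∈ Set.Icc (0 : ℝ) 1, IsUnit (Φ₁ x) ∧ IsUnit (Φ₂ x)) ∧
        IsUnit (C₁ + D₁ * Φ₁ 1) ∧ IsUnit (C₂ + D₂ * Φ₂ 1) ∧
        (∀ j k, IntervalIntegrable
          (fun x => DiracBVP.traceIntegrand b C₁ D₁ C₂ D₂ Φ₁ Φ₂ x j k)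
          MeasureTheory.volume 0 1) ∧
        DiracBVP.HasTrace
          (DiracBVP.resolventOf (DiracBVP.bvpOperator b Q₁ C₁ D₁) z -
            DiracBVP.resolventOf (DiracBVP.bvpOperator b Q₂ C₂ D₂) z)
          (DiracBVP.matrixIntegral
            (DiracBVP.traceIntegrand b C₁ D₁ C₂ D₂ Φ₁ Φ₂)).trace := by
  obtain ⟨Φ₁, hΦ₁⟩ := DiracBVP.exists_isFundamentalMatrix hb hQ₁ z
  obtain ⟨Φ₂, hΦ₂⟩ := DiracBVP.exists_isFundamentalMatrix hb hQ₂ z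
  obtain ⟨Ψ₁, P₁⟩ := hΦ₁.exists_isFundamentalPair hb hQ₁
  obtain ⟨Ψ₂, P₂⟩ := hΦ₂.exists_isFundamentalPair hb hQ₂
  refine ⟨(DiracBVP.isTraceClass_and_hasTrace_resolventOf_sub hb P₁ P₂
    (DiracBVP.isUnit_boundary hb hQ₁ P₁ hz₁) (DiracBVP.isUnit_boundary hb hQ₂ P₂ hz₂) hz₁ hz₂).1,
    ⟨Φ₁, hΦ₁⟩, ⟨Φ₂, hΦ₂⟩, fun Φ₁ Φ₂ hΦ₁ hΦ₂ => ?_⟩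
  -- The argument is repeated for arbitrary `Φ₁`, `Φ₂`: every normalized fundamental matrix has an
  -- inverse partner, so uniqueness need not be invoked.
  obtain ⟨Ψ₁, P₁⟩ := hΦ₁.exists_isFundamentalPair hb hQ₁
  obtain ⟨Ψ₂, P₂⟩ := hΦ₂.exists_isFundamentalPair hb hQ₂
  have hU₁ := DiracBVP.isUnit_boundary hb hQ₁ P₁ hz₁
  have hU₂ := DiracBVP.isUnit_boundary hb hQ₂ P₂ hz₂
  exact ⟨fun x hx => ⟨P₁.isUnit hx, P₂.isUnit hx⟩, hU₁, hU₂,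
    DiracBVP.intervalIntegrable_traceIntegrand P₁ P₂,
    (DiracBVP.isTraceClass_and_hasTrace_resolventOf_sub hb P₁ P₂ hU₁ hU₂ hz₁ hz₂).2⟩
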